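/- Let $q\neq 0$ be an element of a field of characteristic different from $2$ that is not a root of unity (for example an indeterminate over $\mathbb{Q}$). Put $w_v=\frac{q^v+q^{-v}}2$ for $v\in\mathbb{Z}$, and $(x;p)_N=\prod_{j=0}^{N-1}(1-xp^j)$. **Regions and tilings.** In the triangular lattice with horizontal lattice lines measure horizontal distances in half units. For integers $h$ and $n\ge 0$ let $Q_{h,n}$ (the *quarter hexagon* of height $h$ with top side $n$) be the region consisting of $h$ rows of unit triangles (numbered $1,\dots,h$ from top to bottom), where row $r$ consists of the triangles whose vertical axes have the abscissae $1,2,\dots,2n+r$, the one in row $r$ with abscissa $x$ pointing up iff $r+x$ is even; so its left boundary is a vertical zigzag line ($Q_{h,n}$ is empty if $h\le 0$). For integers $m,k,n\ge 0$ let $R_{m,k,n}$ be the subregion of $Q_{2m-1+k,n}$ formed by the triangles with $x\ge r-2m+1$ (after row $2m$ the left boundary continues as a straight lattice line; $R_{m,0,n}=Q_{2m-1,n}$ and $R_{m,1,n}=Q_{2m,n}$). For integers $-n\le a_1<\dots<a_m\le m-1$ remove from the bottom row of $R_{m,k,n}$ the $m$ up-pointing triangles (dents) with abscissae $2m-1+k-2a_j$.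 A vertical lozenge (two triangles sharing a horizontal side) is labelled by its abscissa, so labels are vertically constant, increase by $1$ from left to right and start at $1$. The weight of a lozenge tiling is the product of $w_v$ over the labels $v$ of its vertical lozenges, and the tiling generating function is the sum of the weights of all lozenge tilings of the dented region. **Paths.** Lattice paths in $\mathbb{Z}\times\mathbb{Z}$ have steps $(a,b)\to(a+1,b)$ of weight $w_{a-2b}$ and steps $(a,b)\to(a,b-1)$ of weight $1$; the weight of a path or of a family of paths is the product of the weights of all its steps. Let $\mathfrak{gf}(a,b,c,d)$ be the sum of the weights of all lattice paths from $(a,b)$ to $(c,d)$. **Claims.** 1. $\mathfrak{gf}(a,b,c,d)=0$ if $a>c$ or $b<d$; if $a\le c$ and $b\ge d$, then $$\mathfrak{gf}(a,b,c,d)=\frac{2^{a-c}\,q^{(a-c)(a+c-4d-1)/2}\,(q^{2(b-d+1)};q^2)_{c-a}\,(-q^{2(a-b-d)};q^2)_{c-a}}{(q^2;q^2)_{c-a}}.$$ 2. Let $m,k\ge0$, let $a_1<\dots<a_m$ be integers, and let $$D=\det_{1\le i,j\le m}\bigl(\mathfrak{gf}(2i-1,i-1,2m-1+k,a_j)\bigr).$$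 Then $D$ is the sum of the weights of all families of $m$ pairwise vertex-disjoint lattice paths joining the points $(2i-1,i-1)$, $1\le i\le m$, bijectively to the points $(2m-1+k,a_j)$, $1\le j\le m$. If $a_m\ge m$, then $D=0$. 3. If moreover $a_m\le m-1$, then for all $1\le i,j\le m$ $$\mathfrak{gf}(2i-1,i-1,2m-1+k,a_j)=\frac{2^{2i-k-2m}\,q^{(2i-k-2m)(2i+k+2m-4a_j-3)/2}\,(q^{4(i-a_j)};q^4)_{2m+k-2i}}{(q^2;q^2)_{2m+k-2i}},$$ and $D$ factorizes completely: $$D=\prod_{i=1}^m\frac{2^{2i-k-2m}\,q^{(2i-k-2m)(2i+k+2m-3)/2}}{(q^2;q^2)_{2m+k-2i}}\cdot\prod_{j=1}^m q^{2(2m+k)a_j}\cdot q^{4\left(\frac{m(m-1)(2m+k-1)}2-\sum_{l=1}^m a_l(2m-l)\right)}$$ $$\times\prod_{j=1}^m(q^{4(m-a_j)};q^4)_k\cdot\prod_{1\le i<j\le m}\bigl(1-q^{4(a_i-a_j)}\bigr)\bigl(1-q^{4(-2m-k+1+a_i+a_j)}\bigr).$$ 4. If $-n\le a_1<\dots<a_m\le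 m-1$, then there is a weight-preserving bijection between the lozenge tilings of $R_{m,k,n}$ with the dents given by $a_1,\dots,a_m$ removed and the families of paths in 2. Hence the tiling generating function of this region equals $D$, and thus the product in 3, for every $k\ge 0$. In particular, the tiling generating functions of the dented quarter hexagons of odd height $2m-1$ and of even height $2m$ are given by the product in 3 with $k=0$ and $k=1$, respectively. -/

import Mathlib

open scoped BigOperators

noncomputable section

namespace QuarterHexagon

/-! ### Lozenge tilings

The triangular lattice has horizontal lattice lines; horizontal distances are measured in half units.
The unit triangle in the `r`-th row (rows are counted downwards) whose vertical axis of symmetry has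
abscissa `x` is encoded by `(r, x)`. It points up if `r + x` is even, and down otherwise. Thus the
up-pointing triangle `(r, x)` shares its left side with `(r, x - 1)`, its right side with
`(r, x + 1)`, and its base with `(r + 1, x)`. -/

/-- The vertical lozenge whose upper half is the triangle `t` (which must point up). -/
def verticalLozenge (t : ℤ × ℤ) : Finset (ℤ × ℤ) := {t, (t.1 + 1, t.2)}

/-- A lozenge: the union of an up-pointing triangle with one of its three neighbours
(the last case is that of the vertical lozenges). -/
def IsLozenge (L : Finset (ℤ × ℤ)) : Prop :=
  ∃ t : ℤ × ℤ, Even (t.1 + t.2) ∧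
    (L = {t, (t.1, t.2 - 1)} ∨ L = {t, (t.1, t.2 + 1)} ∨ L = verticalLozenge t)

/-- `T` is a lozenge tiling of the region `R`. -/
def IsLozengeTiling (R : Finset (ℤ × ℤ)) (T : Finset (Finset (ℤ × ℤ))) : Prop :=
  (∀ L ∈ T, IsLozenge L) ∧ (T : Set (Finset (ℤ × ℤ))).PairwiseDisjoint id ∧ T.biUnion id = R

open Classical in
/-- The finite set of all lozenge tilings of `R`. -/
def lozengeTilings (R : Finset (ℤ × ℤ)) : Finset (Finset (Finset (ℤ × ℤ))) :=
  R.powerset.powerset.filter (IsLozengeTiling R)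

theorem mem_lozengeTilings (R : Finset (ℤ × ℤ)) (T : Finset (Finset (ℤ × ℤ))) :
    T ∈ lozengeTilings R ↔ IsLozengeTiling R T := by
  classical
  simp only [lozengeTilings, Finset.mem_filter, Finset.mem_powerset, and_iff_right_iff_imp]
  intro h L hL
  rw [Finset.mem_powerset, ← h.2.2]
  exact Finset.subset_biUnion_of_mem id hL

/-- The weight `w_v = (q^v + q^(-v)) / 2` of the label `v`. -/
def labelWeight {K : Type*} [Field K] (q : K) (v : ℤ) : K := (q ^ v + q ^ (-v)) / 2

open Classical in
/-- The weight of a tiling `T` of `R`: the product of the weights of the labels of all vertical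
lozenges of `T`, where the label of a vertical lozenge is its abscissa. -/
def tilingWeight {K : Type*} [Field K] (q : K) (R : Finset (ℤ × ℤ))
    (T : Finset (Finset (ℤ × ℤ))) : K :=
  ∏ t ∈ R.filter (fun t => Even (t.1 + t.2) ∧ verticalLozenge t ∈ T), labelWeight q t.2

/-- The generating function of all lozenge tilings of `R`. -/
def tilingGF {K : Type*} [Field K] (q : K) (R : Finset (ℤ × ℤ)) : K :=
  ∑ T ∈ lozengeTilings R, tilingWeight q R T

/-! ### Quarter hexagons with dents -/

/-- The quarter hexagon of height `h` with top side of length `n`: it consists of `h` rows, its left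
boundary is a vertical zigzag line, its right boundary a lattice line going down to the right, and
the leftmost triangles have abscissa `1` (so that the labels start at `1`). -/
def quarterHexagon (h : ℤ) (n : ℕ) : Finset (ℤ × ℤ) :=
  (Finset.Icc 1 h ×ˢ Finset.Icc 1 (2 * (n : ℤ) + h)).filter (fun t => t.2 ≤ 2 * (n : ℤ) + t.1)

/-- The region of height `2m - 1 + k` with top side of length `n` whose left boundary is the zigzag
line of the quarter hexagon in the first `2m` rows, and continues below these as a straight lattice
line going down to the right. It is the quarter hexagon itself if `k = 0` or `k = 1`. -/
def generalRegion (m k n : ℕ) : Finset (ℤ × ℤ) :=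
  (quarterHexagon (2 * (m : ℤ) - 1 + k) n).filter (fun t => t.1 - 2 * (m : ℤ) + 1 ≤ t.2)

/-- The dents: up-pointing triangles in the bottom row `h`, at the abscissae `h - 2 a_j`. -/
def dents {m : ℕ} (h : ℤ) (a : Fin m → ℤ) : Finset (ℤ × ℤ) :=
  Finset.univ.image (fun j => (h, h - 2 * a j))

/-! ### Lattice paths -/

/-- A step to the right or downwards in the lattice `ℤ × ℤ`. -/
def IsStep (u v : ℤ × ℤ) : Prop := v = (u.1 + 1, u.2) ∨ v = (u.1, u.2 - 1)

/-- Lattice paths from `p` to `e`, given by the list of their vertices. -/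
def LatticePath (p e : ℤ × ℤ) : Type :=
  {l : List (ℤ × ℤ) // l.head? = some p ∧ l.getLast? = some e ∧ l.IsChain IsStep}

/-- There are only finitely many lattice paths with given end points. -/
theorem finite_latticePath (p e : ℤ × ℤ) : Finite (LatticePath p e) := by
  suffices H : ∀ (N : ℕ) (p : ℤ × ℤ), e.1 - e.2 - (p.1 - p.2) ≤ N →
      {l : List (ℤ × ℤ) | l.head? = some p ∧ l.getLast? = some e ∧ l.IsChain IsStep}.Finite by
    exact (H _ p (Int.self_le_toNat _)).to_subtype
  have mono : ∀ (l : List (ℤ × ℤ)) (p : ℤ × ℤ), l.head? = some p → l.getLast? = some e →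
      l.IsChain IsStep → p.1 - p.2 + (l.length : ℤ) = e.1 - e.2 + 1 := by
    intro l
    induction l with
    | nil => intro p h; simp at h
    | cons x t ih =>
      intro p h h' h''
      simp only [List.head?_cons, Option.some.injEq] at h
      subst h
      cases t with
      | nil =>
        simp only [List.getLast?_singleton, Option.some.injEq] at h'
        subst h'
        simp
      | cons y s =>
        rw [List.isChain_cons_cons] at h''
        have := ih y rfl (by simpa [List.getLast?_cons_cons] using h') h''.2
        rcases h''.1 with h1 | h1 <;> subst h1 <;> simp at this ⊢ <;> omega
  intro N
  induction N with
  | zero =>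
    intro p hp
    refine (Set.finite_singleton [p]).subset ?_
    rintro l ⟨h1, h2, h3⟩
    have := mono l p h1 h2 h3
    match l, h1 with
    | [x], h1 => simpa using h1
    | x :: y :: s, h1 => simp at this; push_cast at hp; omega
  | succ N ih =>
    intro p hp
    push_cast at hp
    have f1 := ih (p.1 + 1, p.2) (by simp only; omega)
    have f2 := ih (p.1, p.2 - 1) (by simp only; omega)
    refine ((Set.finite_singleton [p]).union
      ((f1.image (List.cons p)).union (f2.image (List.cons p)))).subset ?_
    rintro l ⟨h1, h2, h3⟩
    match l, h1 with
    | [x], h1 => left; simpa using h1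
    | x :: y :: s, h1 =>
      right
      simp only [List.head?_cons, Option.some.injEq] at h1
      subst h1
      rw [List.isChain_cons_cons] at h3
      have h2' : (y :: s).getLast? = some e := by simpa [List.getLast?_cons_cons] using h2
      rcases h3.1 with hy | hy
      · exact Or.inl ⟨y :: s, ⟨by simp [hy], h2', h3.2⟩, rfl⟩
      · exact Or.inr ⟨y :: s, ⟨by simp [hy], h2', h3.2⟩, rfl⟩

instance instFintypeLatticePath (p e : ℤ × ℤ) : Fintype (LatticePath p e) :=
  haveI := finite_latticePath p e
  Fintype.ofFinite _

open Classical in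
/-- The horizontal step from `(a, b)` to `(a + 1, b)` has the label `a - 2 b`, and downward steps
have weight `1`. -/
def stepWeight {K : Type*} [Field K] (q : K) (u v : ℤ × ℤ) : K :=
  if v = (u.1 + 1, u.2) then labelWeight q (u.1 - 2 * u.2) else 1

/-- The weight of a lattice path: the product of the weights of its steps. -/
def pathWeight {K : Type*} [Field K] (q : K) {p e : ℤ × ℤ} (P : LatticePath p e) : K :=
  (List.zipWith (stepWeight q) P.1 P.1.tail).prod

/-- The generating function of all lattice paths from `(a, b)` to `(c, d)`. -/
def gf {K : Type*} [Field K] (q : K) (a b c d : ℤ) : K :=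
  ∑ P : LatticePath (a, b) (c, d), pathWeight q P

/-- The `i`-th initial point `(2i - 1, i - 1)`, for `i = 1, …, m`. -/
def initialPoint {m : ℕ} (i : Fin m) : ℤ × ℤ := (2 * ((i : ℤ) + 1) - 1, ((i : ℤ) + 1) - 1)

/-- The `j`-th terminal point `(2m - 1 + k, a_j)`. -/
def terminalPoint {m : ℕ} (k : ℕ) (a : Fin m → ℤ) (j : Fin m) : ℤ × ℤ :=
  (2 * (m : ℤ) - 1 + k, a j)

/-- Families of non-intersecting lattice paths joining the initial points to the terminal points
(in any order). -/
def NonIntersectingFamily {m : ℕ} (k : ℕ) (a : Fin m → ℤ) : Type :=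
  {F : Σ σ : Equiv.Perm (Fin m),
      ∀ i : Fin m, LatticePath (initialPoint i) (terminalPoint k a (σ i)) //
    ∀ i j : Fin m, i ≠ j → List.Disjoint (F.2 i).1 (F.2 j).1}

open Classical in
instance instFintypeNonIntersectingFamily {m : ℕ} (k : ℕ) (a : Fin m → ℤ) :
    Fintype (NonIntersectingFamily k a) := by
  unfold NonIntersectingFamily
  infer_instance

/-- The weight of a family of paths: the product of the weights of the paths. -/
def familyWeight {K : Type*} [Field K] (q : K) {m k : ℕ} {a : Fin m → ℤ}
    (F : NonIntersectingFamily k a) : K :=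
  ∏ i : Fin m, pathWeight q (F.1.2 i)

/-- The `m × m` matrix with entries `gf (2i - 1, i - 1, 2m - 1 + k, a_j)`, `1 ≤ i, j ≤ m`. -/
def gfMatrix {K : Type*} [Field K] (q : K) {m : ℕ} (k : ℕ) (a : Fin m → ℤ) :
    Matrix (Fin m) (Fin m) K :=
  Matrix.of fun i j =>
    gf q (2 * ((i : ℤ) + 1) - 1) (((i : ℤ) + 1) - 1) (2 * (m : ℤ) - 1 + k) (a j)

/-! ### Product formulas -/

/-- The `q`-Pochhammer symbol `(x; q)_n`. -/
def qPoch {K : Type*} [Field K] (x q : K) (n : ℕ) : K := ∏ j ∈ Finset.range n, (1 - x * q ^ j)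

/-- The product formula for the generating function of lattice paths from `(a, b)` to `(c, d)`. -/
def gfFormula {K : Type*} [Field K] (q : K) (a b c d : ℤ) : K :=
  2 ^ (a - c) * q ^ ((a - c) * (a + c - 4 * d - 1) / 2)
    * qPoch (q ^ (2 * (b - d + 1))) (q ^ 2) (c - a).toNat
    * qPoch (-q ^ (2 * (a - b - d))) (q ^ 2) (c - a).toNat
    / qPoch (q ^ 2) (q ^ 2) (c - a).toNat

/-- The product formula for the generating function of lattice paths from `(2i - 1, i - 1)` to
`(2m - 1 + k, α)`, for `1 ≤ i ≤ m`. -/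
def gfSpecialFormula {K : Type*} [Field K] (q : K) (m k i : ℕ) (α : ℤ) : K :=
  2 ^ (2 * (i : ℤ) - k - 2 * m)
    * q ^ ((2 * (i : ℤ) - k - 2 * m) * (2 * (i : ℤ) + k + 2 * m - 4 * α - 3) / 2)
    * qPoch (q ^ (4 * ((i : ℤ) - α))) (q ^ 4) (2 * m + k - 2 * i)
    / qPoch (q ^ 2) (q ^ 2) (2 * m + k - 2 * i)

/-- The complete factorization of the determinant: the first two products collect the factors that
depend only on the row or only on the column, the remaining ones are the evaluation of
`det (q ^ (-4 i a_j) (q ^ (4 (i - a_j)); q ^ 4)_{2m + k - 2i})`. -/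
def completeProduct {K : Type*} [Field K] (q : K) {m : ℕ} (k : ℕ) (a : Fin m → ℤ) : K :=
  (∏ i ∈ Finset.Icc 1 m,
      2 ^ (2 * (i : ℤ) - k - 2 * m)
        * q ^ ((2 * (i : ℤ) - k - 2 * m) * (2 * (i : ℤ) + k + 2 * m - 3) / 2)
        / qPoch (q ^ 2) (q ^ 2) (2 * m + k - 2 * i))
    * (∏ j : Fin m, q ^ (2 * (2 * (m : ℤ) + k) * a j))
    * q ^ (4 * ((m : ℤ) * ((m : ℤ) - 1) * (2 * m + k - 1) / 2
        - ∑ l : Fin m, a l * (2 * (m : ℤ) - ((l : ℤ) + 1))))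
    * (∏ j : Fin m, qPoch (q ^ (4 * ((m : ℤ) - a j))) (q ^ 4) k)
    * ∏ i : Fin m, ∏ j ∈ Finset.Ioi i,
        (1 - q ^ (4 * (a i - a j))) * (1 - q ^ (4 * (-2 * (m : ℤ) - k + 1 + a i + a j)))

end QuarterHexagon

end

noncomputable section

namespace QuarterHexagon

/-! ### Lattice paths as lists of vertices -/

/-! Single paths: splitting off the first step gives gf(a,b) = w_{a-2b} gf(a+1,b) + gf(a,b-1), with
the end point fixed. The product formula satisfies the same recursion (`gfFormula_step`) and the
same boundary values, so the two agree by induction on the number of steps.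

Families: the Lindström–Gessel–Viennot identity (`signed_sum_eq_det`) is obtained without a
tail-swapping involution. Both the signed sum over disjoint families and the determinant are
functions of the tuple of starting points, and both obey the one-step recursion in a suitably chosen
starting point: the determinant by linearity in a row, the sum by removing the first vertex of a
path. Both vanish when two starting points collide, and they agree when every starting point is an
end point. For the given points, disjointness forces the identity permutation
(`IsPathList.end_lt_end`), so all signs are positive.

Determinant: at the starting points (2i-1, i-1) the two numerator symbols combine into one symbol
with base q^4 and 2(m-i)+k factors. The middle k factors depend on the column only. The outer ones,
paired from the inside out, make a monic polynomial of degree m-i in x_j = q^(4a_j) +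
q^(4(2m+k-1)-4a_j), up to a power of q (`qPoch_pairing`). After row and column factors are
extracted, a Vandermonde determinant in the x_j remains, and each x_i - x_j factorizes.

Tilings: each vertex (a,b) stands for the up-pointing triangle (a, a-2b) and for its left neighbour.
A lozenge then joins the up-triangle of u to the down-triangle of w, where w = u or w is one step
from u; vertical lozenges are the horizontal steps. A tiling is thus a matching of the vertices that
are not end points with those that are not starting points, and its non-fixed vertices form disjoint
paths. This is the weight-preserving bijection `exists_equiv_of_isPathRegion`. -/

/-- `l` is the list of the vertices of a lattice path from `p` to `e`. -/
def IsPathList (p e : ℤ × ℤ) (l : List (ℤ × ℤ)) : Prop :=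
  l.head? = some p ∧ l.getLast? = some e ∧ l.IsChain IsStep

/-- The potential `a - b` of the vertex `(a, b)`; it grows by `1` with each step. -/
def pot (v : ℤ × ℤ) : ℤ := v.1 - v.2

theorem IsStep.pot_eq {u v : ℤ × ℤ} (h : IsStep u v) : pot v = pot u + 1 := by
  rcases h with h | h <;> subst h <;> simp only [pot] <;> ring

theorem IsPathList.singleton (p : ℤ × ℤ) : IsPathList p p [p] := by
  simp [IsPathList]

theorem IsPathList.cons {p v e : ℤ × ℤ} {l : List (ℤ × ℤ)} (hs : IsStep p v)
    (h : IsPathList v e l) : IsPathList p e (p :: l) := by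
  obtain ⟨h1, h2, h3⟩ := h
  cases l with
  | nil => simp at h1
  | cons x t =>
    simp only [List.head?_cons, Option.some.injEq] at h1
    subst h1
    exact ⟨rfl, by simpa [List.getLast?_cons_cons] using h2, List.isChain_cons_cons.2 ⟨hs, h3⟩⟩

theorem IsPathList.eq_or_cons {p e : ℤ × ℤ} {l : List (ℤ × ℤ)} (h : IsPathList p e l) :
    (p = e ∧ l = [p]) ∨ ∃ v l', IsStep p v ∧ IsPathList v e l' ∧ l = p :: l' := by
  obtain ⟨h1, h2, h3⟩ := h
  match l, h1 with
  | [x], h1 =>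
    simp only [List.head?_cons, Option.some.injEq] at h1
    subst h1
    left
    simpa using h2
  | x :: y :: s, h1 =>
    simp only [List.head?_cons, Option.some.injEq] at h1
    subst h1
    rw [List.isChain_cons_cons] at h3
    exact Or.inr ⟨y, y :: s, h3.1, ⟨rfl, by simpa [List.getLast?_cons_cons] using h2, h3.2⟩, rfl⟩

/-- Induction along a lattice path, from its end to its start. -/
theorem IsPathList.rec_cons {e : ℤ × ℤ} {C : ℤ × ℤ → List (ℤ × ℤ) → Prop} (h0 : C e [e])
    (h1 : ∀ p v l, IsStep p v → IsPathList v e l → C v l → C p (p :: l)) :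
    ∀ {l : List (ℤ × ℤ)} {p : ℤ × ℤ}, IsPathList p e l → C p l := by
  intro l
  induction l with
  | nil => intro p h; simpa using h.1
  | cons x t ih =>
    intro p h
    rcases h.eq_or_cons with ⟨rfl, hx⟩ | ⟨v, l', hs, hl, hx⟩
    · rw [hx]; exact h0
    · obtain ⟨rfl, rfl⟩ := List.cons.inj hx
      exact h1 _ v _ hs hl (ih hl)

theorem IsPathList.start_mem {p e : ℤ × ℤ} {l : List (ℤ × ℤ)} (h : IsPathList p e l) : p ∈ l :=
  List.mem_of_mem_head? h.1

theorem IsPathList.end_mem {p e : ℤ × ℤ} {l : List (ℤ × ℤ)} (h : IsPathList p e l) : e ∈ l :=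
  List.mem_of_mem_getLast? h.2.1

theorem IsPathList.mem_bounds {p e : ℤ × ℤ} {l : List (ℤ × ℤ)} (h : IsPathList p e l) :
    ∀ v ∈ l, p.1 ≤ v.1 ∧ v.2 ≤ p.2 ∧ v.1 ≤ e.1 ∧ e.2 ≤ v.2 := by
  refine IsPathList.rec_cons
    (C := fun p l => ∀ v ∈ l, p.1 ≤ v.1 ∧ v.2 ≤ p.2 ∧ v.1 ≤ e.1 ∧ e.2 ≤ v.2) ?_ ?_ h
  · intro v hv
    simp only [List.mem_singleton] at hv
    simp [hv]
  · intro p v l hs hl ih u hu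
    have hv := ih v hl.start_mem
    rcases List.mem_cons.1 hu with rfl | hu
    · rcases hs with hs | hs <;> subst hs <;> simp only at hv ⊢ <;> omega
    · have := ih u hu
      rcases hs with hs | hs <;> subst hs <;> simp only at hv this ⊢ <;> omega

theorem IsPathList.pot_le {p e : ℤ × ℤ} {l : List (ℤ × ℤ)} (h : IsPathList p e l)
    {v : ℤ × ℤ} (hv : v ∈ l) : pot p ≤ pot v := by
  have := h.mem_bounds v hv
  simp only [pot]; omega

theorem IsPathList.pot_le_end {p e : ℤ × ℤ} {l : List (ℤ × ℤ)} (h : IsPathList p e l)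
    {v : ℤ × ℤ} (hv : v ∈ l) : pot v ≤ pot e := by
  have := h.mem_bounds v hv
  simp only [pot]; omega

theorem IsPathList.eq_start {p e : ℤ × ℤ} {l : List (ℤ × ℤ)} (h : IsPathList p e l)
    {v : ℤ × ℤ} (hv : v ∈ l) (hp : pot v ≤ pot p) : v = p := by
  have := h.mem_bounds v hv
  simp only [pot] at hp
  ext <;> omega

theorem IsPathList.eq_singleton {p : ℤ × ℤ} {l : List (ℤ × ℤ)} (h : IsPathList p p l) :
    l = [p] := by
  rcases h.eq_or_cons with h | ⟨v, l', hs, hl, h⟩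
  · exact h.2
  · have := hs.pot_eq
    have := hl.pot_le hl.end_mem
    omega

theorem finite_isPathList (p e : ℤ × ℤ) : {l | IsPathList p e l}.Finite :=
  Set.finite_coe_iff.1 (finite_latticePath p e)

/-- The finite set of all lattice paths from `p` to `e`. -/
def pathFinset (p e : ℤ × ℤ) : Finset (List (ℤ × ℤ)) := (finite_isPathList p e).toFinset

@[simp] theorem mem_pathFinset {p e : ℤ × ℤ} {l : List (ℤ × ℤ)} :
    l ∈ pathFinset p e ↔ IsPathList p e l := by
  simp [pathFinset]

/-! ### Generating functions of single paths and their one-step recursion -/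

section Weights

variable {K : Type*} [Field K] (q : K)

/-- The weight of a lattice path given as a list. -/
def listWeight (l : List (ℤ × ℤ)) : K := (List.zipWith (stepWeight q) l l.tail).prod

@[simp] theorem listWeight_singleton (p : ℤ × ℤ) : listWeight q [p] = 1 := by
  simp [listWeight]

theorem listWeight_cons {p v e : ℤ × ℤ} {l : List (ℤ × ℤ)} (h : IsPathList v e l) :
    listWeight q (p :: l) = stepWeight q p v * listWeight q l := by
  cases l with
  | nil => simpa using h.1
  | cons x t =>
    have := h.1
    simp only [List.head?_cons, Option.some.injEq] at this
    subst this
    simp [listWeight]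

theorem stepWeight_right (a b : ℤ) :
    stepWeight q (a, b) (a + 1, b) = labelWeight q (a - 2 * b) := by
  simp [stepWeight]

theorem stepWeight_down (a b : ℤ) : stepWeight q (a, b) (a, b - 1) = 1 := by
  simp [stepWeight]

/-- The generating function of lattice paths, as a function of the end points. -/
def pathGF (p e : ℤ × ℤ) : K := ∑ l ∈ pathFinset p e, listWeight q l

theorem gf_eq_pathGF (a b c d : ℤ) : gf q a b c d = pathGF q (a, b) (c, d) := by
  refine Finset.sum_bij (fun P _ => P.1) ?_ ?_ ?_ ?_
  · intro P _
    exact mem_pathFinset.2 P.2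
  · intro P _ P' _ h
    exact Subtype.ext h
  · intro l hl
    exact ⟨⟨l, mem_pathFinset.1 hl⟩, Finset.mem_univ _, rfl⟩
  · intro P _
    rfl

theorem pathGF_self (p : ℤ × ℤ) : pathGF q p p = 1 := by
  have : pathFinset p p = {[p]} := by
    ext l
    rw [mem_pathFinset, Finset.mem_singleton]
    exact ⟨fun h => h.eq_singleton, fun h => h ▸ IsPathList.singleton p⟩
  simp [pathGF, this]

theorem pathGF_eq_zero {p e : ℤ × ℤ} (h : e.1 < p.1 ∨ p.2 < e.2) : pathGF q p e = 0 := by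
  have : pathFinset p e = ∅ := by
    refine Finset.eq_empty_of_forall_notMem fun l hl => ?_
    rw [mem_pathFinset] at hl
    have := hl.mem_bounds p hl.start_mem
    omega
  simp [pathGF, this]

theorem pathFinset_eq_union {a b : ℤ} {e : ℤ × ℤ} (h : (a, b) ≠ e) :
    pathFinset (a, b) e = (pathFinset (a + 1, b) e).image (List.cons (a, b)) ∪
      (pathFinset (a, b - 1) e).image (List.cons (a, b)) := by
  ext l
  simp only [Finset.mem_union, Finset.mem_image, mem_pathFinset]
  constructor
  · intro hl
    rcases hl.eq_or_cons with hl | ⟨v, l', hs, hl, rfl⟩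
    · exact absurd hl.1 h
    · rcases hs with rfl | rfl
      · exact Or.inl ⟨l', hl, rfl⟩
      · exact Or.inr ⟨l', hl, rfl⟩
  · rintro (⟨l', hl, rfl⟩ | ⟨l', hl, rfl⟩)
    · exact hl.cons (Or.inl rfl)
    · exact hl.cons (Or.inr rfl)

theorem pathGF_step {a b : ℤ} {e : ℤ × ℤ} (h : (a, b) ≠ e) :
    pathGF q (a, b) e
      = labelWeight q (a - 2 * b) * pathGF q (a + 1, b) e + pathGF q (a, b - 1) e := by
  have inj : ∀ s : Finset (List (ℤ × ℤ)), Set.InjOn (List.cons (a, b)) s :=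
    fun s x _ y _ hxy => (List.cons.inj hxy).2
  rw [pathGF, pathFinset_eq_union h, Finset.sum_union, Finset.sum_image (inj _),
    Finset.sum_image (inj _), pathGF, pathGF, Finset.mul_sum]
  · congr 1
    · refine Finset.sum_congr rfl fun l hl => ?_
      rw [listWeight_cons q (mem_pathFinset.1 hl), stepWeight_right]
    · refine Finset.sum_congr rfl fun l hl => ?_
      rw [listWeight_cons q (mem_pathFinset.1 hl), stepWeight_down, one_mul]
  · rw [Finset.disjoint_left]
    intro l h1 h2
    simp only [Finset.mem_image, mem_pathFinset] at h1 h2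
    obtain ⟨l1, h1, rfl⟩ := h1
    obtain ⟨l2, h2, h3⟩ := h2
    obtain rfl := (List.cons.inj h3).2
    have := h1.1.symm.trans h2.1
    simp at this

/-! ### The product formula for a single path -/

theorem qPoch_succ (x p : K) (n : ℕ) : qPoch x p (n + 1) = qPoch x p n * (1 - x * p ^ n) :=
  Finset.prod_range_succ _ _

theorem qPoch_succ' (x p : K) (n : ℕ) :
    qPoch x p (n + 1) = (1 - x) * qPoch (x * p) p n := by
  simp only [qPoch]
  rw [Finset.prod_range_succ', mul_comm]
  congr 1
  · simp
  · refine Finset.prod_congr rfl fun j _ => ?_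
    ring

theorem qPoch_self_ne_zero {q : K} (hq : ∀ N : ℕ, 0 < N → q ^ N ≠ 1) (n : ℕ) :
    qPoch (q ^ 2) (q ^ 2) n ≠ 0 := by
  refine Finset.prod_ne_zero_iff.2 fun j _ h => ?_
  apply hq (2 * (j + 1)) (by omega)
  rw [pow_mul, pow_succ, mul_comm]
  exact (sub_eq_zero.1 h).symm

variable {q}

theorem gfFormula_self (c b d : ℤ) : gfFormula q c b c d = 1 := by
  simp [gfFormula, qPoch]

/-- The first numerator symbol has argument q^0 = 1, hence a zero factor. This is the boundary value
for an end point one unit above the start. -/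
theorem gfFormula_of_lt {a b c : ℤ} (h : a < c) : gfFormula q a b c (b + 1) = 0 := by
  obtain ⟨n, hn⟩ : ∃ n : ℕ, (c - a).toNat = n + 1 := ⟨(c - a).toNat - 1, by omega⟩
  simp [gfFormula, hn, qPoch_succ']

/-- With A = q^(2(b-d)), B = q^(2(a-b-d)), Z = q^(2(n+1)) and c = a+1+n, cancelling common factors
leaves (1-AZ)(1+B) = (A+B)(1-Z) + (1-A)(1+BZ). -/
theorem gfFormula_step (h2 : (2 : K) ≠ 0) (hq0 : q ≠ 0) (hq : ∀ N : ℕ, 0 < N → q ^ N ≠ 1)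
    {a b c d : ℤ} (h : a < c) :
    gfFormula q a b c d
      = labelWeight q (a - 2 * b) * gfFormula q (a + 1) b c d + gfFormula q a (b - 1) c d := by
  obtain ⟨n, rfl⟩ : ∃ n : ℕ, c = a + 1 + n := ⟨(c - a - 1).toNat, by omega⟩
  have e1 : (a + 1 + (n : ℤ) - a).toNat = n + 1 := by omega
  have e2 : (a + 1 + (n : ℤ) - (a + 1)).toNat = n := by omega
  have hden := qPoch_self_ne_zero hq n
  have hden' := qPoch_self_ne_zero hq (n + 1)
  -- The integer s makes the halved exponents of the prefactors explicit; those for a and a+1 then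
  -- differ by a - 2d.
  obtain ⟨s, hs⟩ : ∃ s : ℤ, (n : ℤ) * (n + 1) = 2 * s := by
    obtain ⟨s, hs⟩ := Int.even_mul_succ_self (n : ℤ)
    exact ⟨s, by rw [hs]; ring⟩
  -- the exponents of the prefactors
  have x1 : (a - (a + 1 + (n : ℤ))) * (a + (a + 1 + n) - 4 * d - 1) / 2
      = -(n + 1) * (a - 2 * d) - s := by
    rw [show (a - (a + 1 + (n : ℤ))) * (a + (a + 1 + n) - 4 * d - 1)
      = 2 * (-(n + 1) * (a - 2 * d) - s) by linear_combination -hs]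
    exact Int.mul_ediv_cancel_left _ two_ne_zero
  have x2 : (a + 1 - (a + 1 + (n : ℤ))) * (a + 1 + (a + 1 + n) - 4 * d - 1) / 2
      = (-(n + 1) * (a - 2 * d) - s) + (a - 2 * d) := by
    rw [show (a + 1 - (a + 1 + (n : ℤ))) * (a + 1 + (a + 1 + n) - 4 * d - 1)
      = 2 * ((-(n + 1) * (a - 2 * d) - s) + (a - 2 * d)) by linear_combination -hs]
    exact Int.mul_ediv_cancel_left _ two_ne_zero
  simp only [gfFormula, e1, e2, x1, x2]
  generalize -((n : ℤ) + 1) * (a - 2 * d) - s = E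
  have y1 : q ^ (2 * (b - d + 1)) = q ^ (2 * (b - 1 - d + 1)) * q ^ 2 := by
    rw [← zpow_natCast q 2, ← zpow_add₀ hq0]; congr 1; push_cast; ring
  have y2 : q ^ (2 * (a - (b - 1) - d)) = q ^ (2 * (a - b - d)) * q ^ 2 := by
    rw [← zpow_natCast q 2, ← zpow_add₀ hq0]; congr 1; push_cast; ring
  have y3 : q ^ (2 * (a + 1 - b - d)) = q ^ (2 * (a - b - d)) * q ^ 2 := by
    rw [← zpow_natCast q 2, ← zpow_add₀ hq0]; congr 1; push_cast; ring
  -- That difference q^(a-2d) turns the label weight into (A+B)/2.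
  have y4 : labelWeight q (a - 2 * b) * q ^ (a - 2 * d)
      = (q ^ (2 * (a - b - d)) + q ^ (2 * (b - 1 - d + 1))) / 2 := by
    rw [labelWeight, div_mul_eq_mul_div, add_mul, ← zpow_add₀ hq0, ← zpow_add₀ hq0]
    congr 3 <;> ring
  have z1 : (2 : K) ^ (a + 1 - (a + 1 + (n : ℤ))) = 2 ^ (a - (a + 1 + (n : ℤ))) * 2 := by
    rw [← zpow_add_one₀ h2]; congr 1; ring
  rw [y2, y3, y1, z1, zpow_add₀ hq0]
  rw [qPoch_succ (q ^ (2 * (b - 1 - d + 1)) * q ^ 2), qPoch_succ' (-q ^ (2 * (a - b - d))),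
    qPoch_succ' (q ^ (2 * (b - 1 - d + 1))), qPoch_succ (-(q ^ (2 * (a - b - d)) * q ^ 2)),
    ← neg_mul]
  rw [qPoch_succ] at hden' ⊢
  have hl := right_ne_zero_of_mul hden'
  generalize q ^ (2 * (a - b - d)) = B at *
  generalize q ^ (2 * (b - 1 - d + 1)) = A at *
  generalize qPoch (A * q ^ 2) (q ^ 2) n = P1
  generalize qPoch (-B * q ^ 2) (q ^ 2) n = P2
  generalize qPoch (q ^ 2) (q ^ 2) n = P3 at *
  generalize (2 : K) ^ (a - (a + 1 + (n : ℤ))) = T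
  generalize q ^ E = Q
  rw [show labelWeight q (a - 2 * b) * (T * 2 * (Q * q ^ (a - 2 * d)) * P1 * P2 / P3)
    = (labelWeight q (a - 2 * b) * q ^ (a - 2 * d)) * (T * 2 * Q * P1 * P2 / P3) by ring, y4]
  generalize hr : q ^ 2 = r at *
  field_simp
  ring

theorem pathGF_eq_gfFormula (h2 : (2 : K) ≠ 0) (hq0 : q ≠ 0) (hq : ∀ N : ℕ, 0 < N → q ^ N ≠ 1)
    {a b c d : ℤ} (hac : a ≤ c) (hdb : d ≤ b) :
    pathGF q (a, b) (c, d) = gfFormula q a b c d := by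
  suffices H : ∀ (N : ℕ) (a b : ℤ), a ≤ c → d ≤ b → (c - a) + (b - d) = N →
      pathGF q (a, b) (c, d) = gfFormula q a b c d from
    H ((c - a) + (b - d)).toNat a b hac hdb (by omega)
  intro N
  induction N with
  | zero =>
    intro a b h1 h2 h3
    obtain rfl : a = c := by push_cast at h3; omega
    obtain rfl : b = d := by push_cast at h3; omega
    rw [pathGF_self, gfFormula_self]
  | succ N ih =>
    intro a b hac hdb h3
    push_cast at h3
    have hne : (a, b) ≠ (c, d) := by
      intro h
      rw [Prod.mk.injEq] at h
      omega
    rw [pathGF_step q hne]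
    rcases hac.lt_or_eq with hac' | rfl
    · rw [gfFormula_step h2 hq0 hq hac', ih (a + 1) b (by omega) hdb (by omega)]
      congr 1
      rcases hdb.lt_or_eq with hdb' | rfl
      · exact ih a (b - 1) hac (by omega) (by omega)
      -- On the line b = d a downward step overshoots the end point, and the formula vanishes there
      -- as well.
      · rw [pathGF_eq_zero q (Or.inr (by simp))]
        have := gfFormula_of_lt (q := q) (b := d - 1) hac'
        rw [sub_add_cancel] at this
        exact this.symm
    · rw [pathGF_eq_zero q (Or.inl (by simp)), mul_zero, zero_add,
        ih a (b - 1) hac (by omega) (by omega), gfFormula_self, gfFormula_self]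

end Weights

/-! ### Families of non-intersecting paths and determinants -/

section Families

variable {m : ℕ}

open Classical in
/-- The families of pairwise disjoint lattice paths from `X i` to `Y i`. -/
def disjointFamilies (X Y : Fin m → ℤ × ℤ) : Finset (Fin m → List (ℤ × ℤ)) :=
  (Fintype.piFinset fun i => pathFinset (X i) (Y i)).filter
    fun f => ∀ i j, i ≠ j → List.Disjoint (f i) (f j)

theorem mem_disjointFamilies {X Y : Fin m → ℤ × ℤ} {f : Fin m → List (ℤ × ℤ)} :
    f ∈ disjointFamilies X Y ↔
      (∀ i, IsPathList (X i) (Y i) (f i)) ∧ ∀ i j, i ≠ j → List.Disjoint (f i) (f j) := by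
  simp [disjointFamilies]

theorem eq_of_mem_disjointFamilies {X Y : Fin m → ℤ × ℤ} {f : Fin m → List (ℤ × ℤ)}
    (hf : f ∈ disjointFamilies X Y) {i j : Fin m} {v : ℤ × ℤ} (hi : v ∈ f i) (hj : v ∈ f j) :
    i = j := by
  by_contra h
  exact (mem_disjointFamilies.1 hf).2 i j h hi hj

theorem disjointFamilies_injective {X Y : Fin m → ℤ × ℤ} {f : Fin m → List (ℤ × ℤ)}
    (hf : f ∈ disjointFamilies X Y) : Function.Injective X := fun i j h =>
  eq_of_mem_disjointFamilies hf ((mem_disjointFamilies.1 hf).1 i).start_mem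
    (h ▸ ((mem_disjointFamilies.1 hf).1 j).start_mem)

/-- The shared vertex lies on both paths. Hence a path starting at some end point can only be the
trivial path. -/
theorem index_eq_of_start_eq_end {X Y : Fin m → ℤ × ℤ} {f : Fin m → List (ℤ × ℤ)}
    (hf : f ∈ disjointFamilies X Y) {i j : Fin m} (h : X i = Y j) : j = i :=
  eq_of_mem_disjointFamilies hf ((mem_disjointFamilies.1 hf).1 j).end_mem
    (h ▸ ((mem_disjointFamilies.1 hf).1 i).start_mem)

theorem disjointFamilies_self {X : Fin m → ℤ × ℤ} (hX : Function.Injective X) :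
    disjointFamilies X X = {fun i => [X i]} := by
  ext f
  rw [mem_disjointFamilies, Finset.mem_singleton]
  constructor
  · rintro ⟨h, -⟩
    funext i
    exact (h i).eq_singleton
  · rintro rfl
    refine ⟨fun i => IsPathList.singleton _, fun i j hij => ?_⟩
    simpa using fun h => hij (hX h).symm

/-- Removing the first vertex of path i always keeps disjointness; the minimality of the potential
is needed for putting it back. Another path that starts at a non-end point could contain (a, b) only
as its first vertex, which injectivity of X excludes; a path that starts at an end point is trivial.
-/
theorem disjointFamilies_eq_union {X Y : Fin m → ℤ × ℤ} (hX : Function.Injective X) {i : Fin m}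
    {a b : ℤ} (hi : X i = (a, b)) (hY : ∀ j, X i ≠ Y j)
    (hmin : ∀ l, (∀ j, X l ≠ Y j) → pot (X i) ≤ pot (X l)) :
    disjointFamilies X Y =
      (disjointFamilies (Function.update X i (a + 1, b)) Y).image
        (fun f => Function.update f i ((a, b) :: f i)) ∪
      (disjointFamilies (Function.update X i (a, b - 1)) Y).image
        (fun f => Function.update f i ((a, b) :: f i)) := by
  have back : ∀ v, IsStep (a, b) v → ∀ f ∈ disjointFamilies (Function.update X i v) Y,
      Function.update f i ((a, b) :: f i) ∈ disjointFamilies X Y := by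
    intro v hv f hf
    have hf' := mem_disjointFamilies.1 hf
    have key : ∀ l, l ≠ i → (a, b) ∉ f l := by
      intro l hl hmem
      have hpath := hf'.1 l
      rw [Function.update_of_ne hl] at hpath
      by_cases hterm : ∀ j, X l ≠ Y j
      · have h1 := hmin l hterm
        rw [hi] at h1
        have := hpath.eq_start hmem h1
        exact hl (hX (this.symm.trans hi.symm))
      · push Not at hterm
        obtain ⟨j, hj⟩ := hterm
        obtain rfl : j = l := index_eq_of_start_eq_end hf (by rw [Function.update_of_ne hl, hj])
        rw [← hj] at hpath
        rw [hpath.eq_singleton, List.mem_singleton] at hmem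
        exact hl (hX (hmem.symm.trans hi.symm))
    refine mem_disjointFamilies.2 ⟨fun l => ?_, fun l l' hl => ?_⟩
    · by_cases h : l = i
      · subst h
        rw [Function.update_self, hi]
        refine IsPathList.cons hv ?_
        simpa using hf'.1 l
      · rw [Function.update_of_ne h]
        simpa [Function.update_of_ne h] using hf'.1 l
    · by_cases h : l = i
      · subst h
        rw [Function.update_self, Function.update_of_ne (Ne.symm hl), List.disjoint_cons_left]
        exact ⟨key _ (Ne.symm hl), hf'.2 _ _ hl⟩
      · by_cases h' : l' = i
        · subst h'
          rw [Function.update_self, Function.update_of_ne h, List.disjoint_cons_right]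
          exact ⟨key _ h, hf'.2 _ _ hl⟩
        · rw [Function.update_of_ne h, Function.update_of_ne h']
          exact hf'.2 _ _ hl
  ext f
  simp only [Finset.mem_union, Finset.mem_image]
  constructor
  · intro hf
    have hf' := mem_disjointFamilies.1 hf
    rcases (hf'.1 i).eq_or_cons with h | ⟨v, l', hs, hl', hfi⟩
    · exact absurd h.1 (hY i)
    · rw [hi] at hs hfi
      have mem : Function.update f i l' ∈ disjointFamilies (Function.update X i v) Y := by
        have hsub : ∀ j, Function.update f i l' j ⊆ f j := by
          intro j
          by_cases h : j = i
          · subst h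
            rw [Function.update_self, hfi]
            exact List.subset_cons_self _ _
          · rw [Function.update_of_ne h]
            exact List.Subset.refl _
        refine mem_disjointFamilies.2 ⟨fun j => ?_, fun j j' hj x hx hx' =>
          hf'.2 j j' hj (hsub j hx) (hsub j' hx')⟩
        by_cases h : j = i
        · subst h
          simpa using hl'
        · simpa [Function.update_of_ne h] using hf'.1 j
      have eq : Function.update (Function.update f i l') i
          ((a, b) :: Function.update f i l' i) = f := by
        rw [Function.update_self, Function.update_idem, ← hfi, Function.update_eq_self]
      rcases hs with rfl | rfl
      · exact Or.inl ⟨_, mem, eq⟩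
      · exact Or.inr ⟨_, mem, eq⟩
  · rintro (⟨g, hg, rfl⟩ | ⟨g, hg, rfl⟩)
    · exact back _ (Or.inl rfl) g hg
    · exact back _ (Or.inr rfl) g hg

variable {K : Type*} [Field K] (q : K)

/-- The generating function of the families of disjoint paths from `X i` to `Y i`. -/
def familyGF (X Y : Fin m → ℤ × ℤ) : K :=
  ∑ f ∈ disjointFamilies X Y, ∏ i, listWeight q (f i)

theorem familyGF_step {X Y : Fin m → ℤ × ℤ} (hX : Function.Injective X) {i : Fin m}
    {a b : ℤ} (hi : X i = (a, b)) (hY : ∀ j, X i ≠ Y j)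
    (hmin : ∀ l, (∀ j, X l ≠ Y j) → pot (X i) ≤ pot (X l)) :
    familyGF q X Y = labelWeight q (a - 2 * b) * familyGF q (Function.update X i (a + 1, b)) Y
      + familyGF q (Function.update X i (a, b - 1)) Y := by
  have inj : Function.Injective
      (fun f : Fin m → List (ℤ × ℤ) => Function.update f i ((a, b) :: f i)) := by
    intro f g h
    funext j
    have hj := congrFun h j
    by_cases h' : j = i
    · subst h'
      simpa using hj
    · simpa [Function.update_of_ne h'] using hj
  have wt : ∀ v, ∀ f ∈ disjointFamilies (Function.update X i v) Y,
      ∏ j, listWeight q (Function.update f i ((a, b) :: f i) j)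
        = stepWeight q (a, b) v * ∏ j, listWeight q (f j) := by
    intro v f hf
    have hfi : IsPathList v (Y i) (f i) := by
      simpa using (mem_disjointFamilies.1 hf).1 i
    rw [← Finset.mul_prod_erase _ _ (Finset.mem_univ i),
      ← Finset.mul_prod_erase _ (fun j => listWeight q (f j)) (Finset.mem_univ i),
      Function.update_self, listWeight_cons q hfi, mul_assoc]
    congr 2
    refine Finset.prod_congr rfl fun j hj => ?_
    rw [Function.update_of_ne (Finset.ne_of_mem_erase hj)]
  rw [familyGF, disjointFamilies_eq_union hX hi hY hmin, Finset.sum_union,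
    Finset.sum_image inj.injOn, Finset.sum_image inj.injOn, familyGF, familyGF, Finset.mul_sum]
  · congr 1
    · refine Finset.sum_congr rfl fun f hf => ?_
      rw [wt _ f hf, stepWeight_right]
    · refine Finset.sum_congr rfl fun f hf => ?_
      rw [wt _ f hf, stepWeight_down, one_mul]
  · rw [Finset.disjoint_left]
    intro f h1 h2
    simp only [Finset.mem_image] at h1 h2
    obtain ⟨g1, h1, rfl⟩ := h1
    obtain ⟨g2, h2, h3⟩ := h2
    obtain rfl := inj h3
    have e1 := ((mem_disjointFamilies.1 h1).1 i).1
    have e2 := ((mem_disjointFamilies.1 h2).1 i).1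
    have := e1.symm.trans e2
    simp at this

theorem familyGF_eq_zero {X Y : Fin m → ℤ × ℤ} (h : ∀ f, f ∉ disjointFamilies X Y) :
    familyGF q X Y = 0 := by
  rw [familyGF, Finset.eq_empty_of_forall_notMem h, Finset.sum_empty]

theorem familyGF_eq_zero_of_not_injective {X Y : Fin m → ℤ × ℤ} (h : ¬ Function.Injective X) :
    familyGF q X Y = 0 :=
  familyGF_eq_zero q fun _ hf => h (disjointFamilies_injective hf)

/-- The matrix of the generating functions of paths from `X i` to `E j`. -/
def pathMatrix (X E : Fin m → ℤ × ℤ) : Matrix (Fin m) (Fin m) K :=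
  Matrix.of fun i j => pathGF q (X i) (E j)

theorem pathMatrix_update (X E : Fin m → ℤ × ℤ) (i : Fin m) (v : ℤ × ℤ) :
    pathMatrix q (Function.update X i v) E
      = (pathMatrix q X E).updateRow i fun j => pathGF q v (E j) := by
  ext l j
  by_cases h : l = i
  · subst h
    simp [pathMatrix]
  · simp [pathMatrix, Function.update_of_ne h, Matrix.updateRow_ne h]

theorem det_pathMatrix_step {X E : Fin m → ℤ × ℤ} {i : Fin m} {a b : ℤ} (hi : X i = (a, b))
    (hE : ∀ j, X i ≠ E j) :
    (pathMatrix q X E).det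
      = labelWeight q (a - 2 * b) * (pathMatrix q (Function.update X i (a + 1, b)) E).det
        + (pathMatrix q (Function.update X i (a, b - 1)) E).det := by
  rw [pathMatrix_update, pathMatrix_update, ← Matrix.det_updateRow_smul,
    ← Matrix.det_updateRow_add]
  congr 1
  conv_lhs => rw [← Matrix.updateRow_eq_self (pathMatrix q X E) i]
  congr 1
  funext j
  simp only [pathMatrix, Matrix.of_apply, Pi.add_apply, Pi.smul_apply, smul_eq_mul, hi]
  exact pathGF_step q (hi ▸ hE j)

/-- Here X = E ∘ τ, and only σ = τ admits a disjoint family, the one of trivial paths. The matrix is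
a row permutation of a unitriangular one, since no path leads upwards in the common column, so both
sides equal the sign of τ. -/
theorem signed_sum_of_ends {E : Fin m → ℤ × ℤ} (hE : ∀ i j, i < j → (E i).1 = (E j).1 ∧
    (E i).2 < (E j).2) {X : Fin m → ℤ × ℤ} (hX : Function.Injective X)
    (hXE : ∀ i, ∃ j, X i = E j) :
    ∑ σ : Equiv.Perm (Fin m), (Equiv.Perm.sign σ : ℤ) • familyGF q X (E ∘ σ)
      = (pathMatrix q X E).det := by
  choose t ht using hXE
  have htinj : Function.Injective t := fun i j h => hX (by rw [ht, ht, h])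
  obtain ⟨τ, rfl⟩ : ∃ τ : Equiv.Perm (Fin m), ⇑τ = t :=
    ⟨Equiv.ofBijective t (Finite.injective_iff_bijective.1 htinj), rfl⟩
  obtain rfl : X = E ∘ τ := funext ht
  rw [Finset.sum_eq_single τ]
  · have h1 : pathMatrix q (E ∘ τ) E = (pathMatrix q E E).submatrix τ id := rfl
    have h2 : (pathMatrix q E E).det = 1 := by
      rw [Matrix.det_of_isLowerTriangular]
      · simp [pathMatrix, pathGF_self]
      · intro i j hij
        exact pathGF_eq_zero q (Or.inr (hE i j hij).2)
    rw [h1, Matrix.det_permute, h2, familyGF, disjointFamilies_self hX]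
    simp
  · intro σ _ hσ
    rw [familyGF_eq_zero, smul_zero]
    intro f hf
    apply hσ
    ext l
    have := index_eq_of_start_eq_end (i := l) (j := σ⁻¹ (τ l)) hf (by simp)
    rw [← Equiv.Perm.eq_inv_iff_eq.1 this.symm]
  · simp

/-- The signed version of the theorem of Lindström, Gessel and Viennot. -/
theorem signed_sum_eq_det {E : Fin m → ℤ × ℤ} (hE : ∀ i j, i < j → (E i).1 = (E j).1 ∧
    (E i).2 < (E j).2) (X : Fin m → ℤ × ℤ) :
    ∑ σ : Equiv.Perm (Fin m), (Equiv.Perm.sign σ : ℤ) • familyGF q X (E ∘ σ)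
      = (pathMatrix q X E).det := by
  obtain ⟨B, hB⟩ : ∃ B : ℤ, ∀ j, pot (E j) < B := by
    obtain ⟨B, hB⟩ := (Set.finite_range fun j => pot (E j)).bddAbove
    exact ⟨B + 1, fun j => Int.lt_add_one_of_le (hB ⟨j, rfl⟩)⟩
  -- The total distance of the starting potentials below B decreases with every step. A starting
  -- point at or beyond B reaches no end point, so the truncation in `toNat` is harmless.
  suffices H : ∀ (N : ℕ) (X : Fin m → ℤ × ℤ), ∑ i, (B - pot (X i)).toNat = N →
      ∑ σ : Equiv.Perm (Fin m), (Equiv.Perm.sign σ : ℤ) • familyGF q X (E ∘ σ)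
        = (pathMatrix q X E).det from H _ X rfl
  intro N
  induction N using Nat.strong_induction_on with
  | _ N ih =>
  intro X hN
  by_cases hX : Function.Injective X
  swap
  -- This collision case takes the place of the usual sign-reversing involution: no disjoint family
  -- exists, and the matrix has two equal rows.
  · have h0 : ∀ Y, familyGF q X Y = 0 := fun Y => familyGF_eq_zero_of_not_injective q hX
    simp only [h0, smul_zero, Finset.sum_const_zero]
    simp only [Function.Injective, not_forall] at hX
    obtain ⟨i, j, h1, h2⟩ := hX
    refine (Matrix.det_zero_of_row_eq h2 ?_).symm
    funext l
    simp [pathMatrix, h1]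
  by_cases hXE : ∀ i, ∃ j, X i = E j
  · exact signed_sum_of_ends q hE hX hXE
  -- The starting point to be moved is one of least potential among those that are not end points,
  -- as the recursion for families requires.
  obtain ⟨i, hi, hmin⟩ : ∃ i, (∀ j, X i ≠ E j) ∧
      ∀ l, (∀ j, X l ≠ E j) → pot (X i) ≤ pot (X l) := by
    classical
    push Not at hXE
    obtain ⟨i, hi⟩ := hXE
    obtain ⟨i, hi, hmin⟩ := Finset.exists_min_image
      (Finset.univ.filter fun i => ∀ j, X i ≠ E j) (fun i => pot (X i)) ⟨i, by simpa using hi⟩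
    simp only [Finset.mem_filter, Finset.mem_univ, true_and] at hi hmin
    exact ⟨i, hi, hmin⟩
  by_cases hpot : B ≤ pot (X i)
  · have hz : ∀ Y : Fin m → ℤ × ℤ, (∀ j, pot (Y j) < B) → familyGF q X Y = 0 := by
      intro Y hY
      refine familyGF_eq_zero q fun f hf => ?_
      have h1 := (mem_disjointFamilies.1 hf).1 i
      have := h1.pot_le h1.end_mem
      have := hY i
      omega
    rw [Matrix.det_eq_zero_of_row_eq_zero i]
    · refine Finset.sum_eq_zero fun σ _ => ?_
      rw [hz (E ∘ σ) fun j => hB (σ j), smul_zero]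
    · intro j
      refine pathGF_eq_zero q ?_
      have := hB j
      simp only [pot] at this hpot
      omega
  have hlt : ∀ v, pot v = pot (X i) + 1 →
      ∑ l, (B - pot (Function.update X i v l)).toNat < N := by
    intro v hv
    rw [← hN]
    refine Finset.sum_lt_sum (fun l _ => ?_) ⟨i, Finset.mem_univ _, ?_⟩
    · by_cases h : l = i
      · subst h
        rw [Function.update_self]
        omega
      · rw [Function.update_of_ne h]
    · rw [Function.update_self]
      omega
  obtain ⟨a, b, hab⟩ : ∃ a b, X i = (a, b) := ⟨_, _, rfl⟩
  have hp : ∀ v, IsStep (a, b) v → pot v = pot (X i) + 1 := fun v hv => by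
    rw [hab]; exact hv.pot_eq
  rw [det_pathMatrix_step q hab hi, ← ih _ (hlt _ (hp _ (Or.inl rfl))) _ rfl,
    ← ih _ (hlt _ (hp _ (Or.inr rfl))) _ rfl, Finset.mul_sum, ← Finset.sum_add_distrib]
  refine Finset.sum_congr rfl fun σ _ => ?_
  rw [familyGF_step (Y := E ∘ σ) q hX hab (fun j => hi (σ j))
    (fun l hl => hmin l fun j => by simpa using hl (σ⁻¹ j)), smul_add, mul_smul_comm]

/-- Disjoint lattice paths that start one below the other end one below the other. -/
theorem IsPathList.end_lt_end : ∀ {l l' : List (ℤ × ℤ)} {p p' e e' : ℤ × ℤ},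
    IsPathList p e l → IsPathList p' e' l' → e.1 = e'.1 → p.1 ≤ p'.1 → p.2 < p'.2 →
      List.Disjoint l l' → e.2 < e'.2 := by
  intro l l'
  induction hn : l.length + l'.length using Nat.strong_induction_on generalizing l l' with
  | _ N ih =>
  intro p p' e e' h h' he h1 h2 hd
  -- The lower path advances while its start lies strictly to the left; in a common column the upper
  -- path advances, and stepping down onto the lower start is forbidden by disjointness. Both moves
  -- preserve the hypotheses.
  rcases h1.lt_or_eq with h1 | h1
  · rcases h.eq_or_cons with ⟨rfl, -⟩ | ⟨v, t, hs, ht, rfl⟩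
    · have := h'.mem_bounds p' h'.start_mem
      omega
    · rw [List.disjoint_cons_left] at hd
      refine ih _ ?_ rfl ht h' he ?_ ?_ hd.2
      · rw [← hn, List.length_cons]; omega
      · rcases hs with rfl | rfl <;> simp only <;> omega
      · rcases hs with rfl | rfl <;> simp only <;> omega
  · rcases h'.eq_or_cons with ⟨rfl, -⟩ | ⟨v, t, hs, ht, rfl⟩
    · have := h.mem_bounds p h.start_mem
      omega
    · rw [List.disjoint_cons_right] at hd
      have hv : v ≠ p := fun hv => hd.2 h.start_mem (hv ▸ ht.start_mem)
      refine ih _ ?_ rfl h ht he ?_ ?_ hd.2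
      · rw [← hn, List.length_cons]; omega
      · rcases hs with rfl | rfl <;> simp only <;> omega
      · rcases hs with rfl | rfl
        · exact h2
        · have : p'.2 - 1 ≠ p.2 := fun h => hv (Prod.ext h1.symm h)
          simp only
          omega

theorem initialPoint_fst_le {i j : Fin m} (h : i < j) :
    (initialPoint i).1 ≤ (initialPoint j).1 ∧ (initialPoint i).2 < (initialPoint j).2 := by
  simp only [initialPoint]
  have : (i : ℕ) < j := h
  omega

theorem gfMatrix_eq_pathMatrix (k : ℕ) (a : Fin m → ℤ) :
    gfMatrix q k a = pathMatrix q initialPoint (terminalPoint k a) := by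
  ext i j
  exact gf_eq_pathGF q _ _ _ _

theorem sum_familyWeight_eq_sum_familyGF (k : ℕ) (a : Fin m → ℤ) :
    ∑ F : NonIntersectingFamily k a, familyWeight q F
      = ∑ σ : Equiv.Perm (Fin m), familyGF q initialPoint (terminalPoint k a ∘ σ) := by
  simp only [familyGF]
  rw [Finset.sum_sigma']
  refine Finset.sum_bij (fun F _ => ⟨F.1.1, fun i => (F.1.2 i).1⟩) ?_ ?_ ?_ ?_
  · intro F _
    simp only [Finset.mem_sigma, Finset.mem_univ, true_and]
    exact mem_disjointFamilies.2 ⟨fun i => (F.1.2 i).2, F.2⟩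
  · rintro ⟨⟨σ, P⟩, hP⟩ - ⟨⟨σ', P'⟩, hP'⟩ - h
    simp only [Sigma.mk.injEq] at h
    obtain ⟨rfl, h⟩ := h
    have h := eq_of_heq h
    have : P = P' := funext fun i => Subtype.ext (congrFun h i)
    subst this
    rfl
  · rintro ⟨σ, f⟩ hf
    simp only [Finset.mem_sigma, Finset.mem_univ, true_and] at hf
    have hf := mem_disjointFamilies.1 hf
    exact ⟨⟨⟨σ, fun i => ⟨f i, hf.1 i⟩⟩, hf.2⟩, Finset.mem_univ _, rfl⟩
  · intro F _
    rfl

/-- Non-crossing makes the permutation of any disjoint family strictly monotone, hence the identity,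
so the signed sum coincides with the unsigned one. -/
theorem sum_familyWeight_eq_det {k : ℕ} {a : Fin m → ℤ} (ha : StrictMono a) :
    ∑ F : NonIntersectingFamily k a, familyWeight q F = (gfMatrix q k a).det := by
  rw [sum_familyWeight_eq_sum_familyGF, gfMatrix_eq_pathMatrix,
    ← signed_sum_eq_det q (fun i j h => ⟨rfl, ha h⟩)]
  refine Finset.sum_congr rfl fun σ _ => ?_
  by_cases hσ : StrictMono σ
  · obtain rfl : σ = 1 := Equiv.ext (congrFun hσ.eq_id)
    simp
  · rw [familyGF_eq_zero, smul_zero]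
    intro f hf
    apply hσ
    intro i j hij
    have hf := mem_disjointFamilies.1 hf
    have := (hf.1 i).end_lt_end (hf.1 j) rfl (initialPoint_fst_le hij).1
      (initialPoint_fst_le hij).2 (hf.2 i j hij.ne)
    exact ha.lt_iff_lt.1 this

theorem det_gfMatrix_eq_zero {k : ℕ} {a : Fin m → ℤ} {j : Fin m} (hj : (m : ℤ) ≤ a j) :
    (gfMatrix q k a).det = 0 := by
  refine Matrix.det_eq_zero_of_column_eq_zero j fun i => ?_
  rw [gfMatrix_eq_pathMatrix]
  refine pathGF_eq_zero q (Or.inr ?_)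
  simp only [initialPoint, terminalPoint]
  omega

end Families

/-! ### Evaluation of the determinant -/

section Determinant

variable {K : Type*} [Field K] {q : K}

theorem qPoch_add (x p : K) (n k : ℕ) :
    qPoch x p (n + k) = qPoch x p n * qPoch (x * p ^ n) p k := by
  simp only [qPoch]
  rw [Finset.prod_range_add]
  congr 1
  refine Finset.prod_congr rfl fun j _ => ?_
  rw [pow_add, mul_assoc]

theorem qPoch_mul_qPoch_neg (x p : K) (n : ℕ) :
    qPoch x p n * qPoch (-x) p n = qPoch (x ^ 2) (p ^ 2) n := by
  simp only [qPoch]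
  rw [← Finset.prod_mul_distrib]
  refine Finset.prod_congr rfl fun j _ => ?_
  ring

theorem qPoch_eq_zero {x p : K} {n j : ℕ} (hj : j < n) (h : x * p ^ j = 1) : qPoch x p n = 0 :=
  Finset.prod_eq_zero (Finset.mem_range.2 hj) (by rw [h, sub_self])

theorem zpow_pow_eq (q : K) (s : ℤ) (n : ℕ) : (q ^ s) ^ n = q ^ (s * n) := by
  rw [← zpow_natCast, ← zpow_mul]

/-- For these starting points b-d+1 and a-b-d both equal i-α, so the symbols combine through
(x;p)(-x;p) = (x²;p²). For α ≥ i both sides vanish: α < m guarantees that the factor of index α-i,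
which is zero, occurs in the product. -/
theorem pathGF_eq_gfSpecialFormula (h2 : (2 : K) ≠ 0) (hq0 : q ≠ 0)
    (hq : ∀ N : ℕ, 0 < N → q ^ N ≠ 1) {m k i : ℕ} {α : ℤ} (him : i ≤ m) (hα : α < m) :
    pathGF q (2 * (i : ℤ) - 1, (i : ℤ) - 1) (2 * (m : ℤ) - 1 + k, α)
      = gfSpecialFormula q m k i α := by
  by_cases hi : α ≤ (i : ℤ) - 1
  · rw [pathGF_eq_gfFormula h2 hq0 hq (by omega) hi, gfFormula, gfSpecialFormula]
    have e1 : (2 * (m : ℤ) - 1 + k - (2 * (i : ℤ) - 1)).toNat = 2 * m + k - 2 * i := by omega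
    have e2 : (2 * (i : ℤ) - 1 - (2 * (m : ℤ) - 1 + k)) = 2 * (i : ℤ) - k - 2 * m := by ring
    have e3 : (2 * (i : ℤ) - 1 + (2 * (m : ℤ) - 1 + k) - 4 * α - 1)
      = 2 * (i : ℤ) + k + 2 * m - 4 * α - 3 := by ring
    have e4 : 2 * ((i : ℤ) - 1 - α + 1) = 2 * (i - α) := by ring
    have e5 : 2 * (2 * (i : ℤ) - 1 - (i - 1) - α) = 2 * (i - α) := by ring
    rw [e1, e2, e3, e4, e5, mul_assoc (_ * _), qPoch_mul_qPoch_neg, ← pow_mul, zpow_pow_eq]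
    congr 4
    push_cast
    ring
  · rw [pathGF_eq_zero q (Or.inr (by simp only; omega)), gfSpecialFormula,
      qPoch_eq_zero (j := (α - i).toNat) (by omega), mul_zero, zero_div]
    rw [← pow_mul, ← zpow_natCast q, ← zpow_add₀ hq0]
    rw [show 4 * ((i : ℤ) - α) + ((4 * (α - i).toNat : ℕ) : ℤ) = 0 by push_cast; omega, zpow_zero]

/-- Here n = m-i. With y = q^(4α), factor s counted backwards in the first block and factor s of the
last block are 1-u/y and 1-v/y, where uv = q^(4(2m+k-1)) does not depend on s. Their product is
y⁻¹(y + uv/y - (u+v)), which involves α only through y and y + uv/y. -/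
theorem qPoch_pairing (hq0 : q ≠ 0) (m k n : ℕ) (α : ℤ) :
    qPoch (q ^ (4 * ((m : ℤ) - n - α))) (q ^ 4) (n + k + n)
      = qPoch (q ^ (4 * ((m : ℤ) - α))) (q ^ 4) k * q ^ (-(4 * α * n))
        * ∏ s ∈ Finset.range n, (q ^ (4 * α) + q ^ (4 * (2 * (m : ℤ) + k - 1) - 4 * α)
          - (q ^ (4 * ((m : ℤ) - 1 - s)) + q ^ (4 * ((m : ℤ) + k + s)))) := by
  have e1 : q ^ (4 * ((m : ℤ) - n - α)) * (q ^ 4) ^ n = q ^ (4 * ((m : ℤ) - α)) := by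
    rw [← zpow_natCast q 4, zpow_pow_eq, ← zpow_add₀ hq0]; congr 1; push_cast; ring
  have e2 : q ^ (4 * ((m : ℤ) - n - α)) * (q ^ 4) ^ (n + k) = q ^ (4 * ((m : ℤ) + k - α)) := by
    rw [← zpow_natCast q 4, zpow_pow_eq, ← zpow_add₀ hq0]; congr 1; push_cast; ring
  have r : qPoch (q ^ (4 * ((m : ℤ) - n - α))) (q ^ 4) n
      = ∏ s ∈ Finset.range n, (1 - q ^ (4 * ((m : ℤ) - 1 - s) - 4 * α)) := by
    rw [qPoch, ← Finset.prod_range_reflect]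
    refine Finset.prod_congr rfl fun s hs => ?_
    have hs := Finset.mem_range.1 hs
    rw [← zpow_natCast q 4, zpow_pow_eq, ← zpow_add₀ hq0]
    congr 2
    rw [Nat.sub_sub, Nat.cast_sub (by omega)]
    push_cast
    ring
  have r' : qPoch (q ^ (4 * ((m : ℤ) + k - α))) (q ^ 4) n
      = ∏ s ∈ Finset.range n, (1 - q ^ (4 * ((m : ℤ) + k + s) - 4 * α)) := by
    refine Finset.prod_congr rfl fun s _ => ?_
    rw [← zpow_natCast q 4, zpow_pow_eq, ← zpow_add₀ hq0]
    congr 2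
    push_cast
    ring
  have r'' : q ^ (-(4 * α * n)) = ∏ s ∈ Finset.range n, q ^ (-(4 * α)) := by
    rw [Finset.prod_const, Finset.card_range, zpow_pow_eq, neg_mul]
  rw [qPoch_add, qPoch_add, e1, e2, mul_right_comm, mul_comm (_ * _) (qPoch _ _ k), mul_assoc, r,
    r', r'', ← Finset.prod_mul_distrib, ← Finset.prod_mul_distrib]
  congr 1
  refine Finset.prod_congr rfl fun s _ => ?_
  have hy : q ^ (4 * α) ≠ 0 := zpow_ne_zero _ hq0
  have hc : q ^ (4 * (2 * (m : ℤ) + k - 1))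
      = q ^ (4 * ((m : ℤ) - 1 - s)) * q ^ (4 * ((m : ℤ) + k + s)) := by
    rw [← zpow_add₀ hq0]; congr 1; ring
  rw [zpow_sub₀ hq0, zpow_sub₀ hq0, zpow_sub₀ hq0, zpow_neg, hc]
  field_simp
  ring

theorem prod_zpow_eq_zpow_sum (hq0 : q ≠ 0) {ι : Type*} (s : Finset ι) (f : ι → ℤ) :
    ∏ i ∈ s, q ^ f i = q ^ ∑ i ∈ s, f i := by
  classical
  induction s using Finset.induction_on with
  | empty => simp
  | insert i s hi ih => rw [Finset.prod_insert hi, Finset.sum_insert hi, ih, zpow_add₀ hq0]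

theorem prod_Icc_one_eq_prod_fin {M : Type*} [CommMonoid M] (f : ℕ → M) (m : ℕ) :
    ∏ i ∈ Finset.Icc 1 m, f i = ∏ i : Fin m, f ((i : ℕ) + 1) := by
  induction m with
  | zero => simp
  | succ m ih => rw [Finset.prod_Icc_succ_top (by omega), Fin.prod_univ_castSucc, ih]; simp

/-- A variant of the Vandermonde determinant whose rows are evaluated monic polynomials of
degrees `m - 1, …, 0`. -/
theorem det_prod_range_sub {m : ℕ} (x : Fin m → K) (c : ℕ → K) :
    (Matrix.of fun i j : Fin m =>
        ∏ s ∈ Finset.range (m - ((i : ℕ) + 1)), (x j - c s)).det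
      = ∏ i : Fin m, ∏ j ∈ Finset.Ioi i, (x i - x j) := by
  have h1 := Matrix.det_eval_matrixOfPolynomials_eq_det_vandermonde (fun i => x (Fin.rev i))
    (fun i : Fin m => ∏ s ∈ Finset.range (i : ℕ), (Polynomial.X - Polynomial.C (c s)))
    (fun i => by simp) (fun i => Polynomial.monic_prod_X_sub_C _ _)
  -- Reversing both index sets makes the degrees increase, and transposing puts the polynomials into
  -- the columns.
  rw [← Matrix.det_submatrix_equiv_self Fin.revPerm, ← Matrix.det_transpose]
  have h2 : ∏ i : Fin m, ∏ j ∈ Finset.Ioi i, (x i - x j)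
      = ∏ i : Fin m, ∏ j ∈ Finset.Ioi i, (x (Fin.rev j) - x (Fin.rev i)) := by
    rw [Finset.prod_sigma', Finset.prod_sigma']
    refine Finset.prod_bij' (fun p _ => ⟨Fin.rev p.2, Fin.rev p.1⟩)
      (fun p _ => ⟨Fin.rev p.2, Fin.rev p.1⟩) ?_ ?_ ?_ ?_ ?_ <;> simp
  rw [h2, ← Matrix.det_vandermonde (fun i => x (Fin.rev i)), h1]
  congr 1
  ext i j
  simp only [Matrix.transpose_apply, Matrix.submatrix_apply, Matrix.of_apply, Fin.revPerm_apply,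
    Fin.val_rev, Polynomial.eval_prod, Polynomial.eval_sub, Polynomial.eval_X, Polynomial.eval_C]
  congr 2
  omega

theorem sum_range_sub_mul_two (c : ℤ) (n : ℕ) :
    ∑ l ∈ Finset.range n, (c - l) * 2 = n * (2 * c - n + 1) := by
  induction n with
  | zero => simp
  | succ n ih => rw [Finset.sum_range_succ, ih]; push_cast; ring

theorem det_eq_completeProduct (h2 : (2 : K) ≠ 0) (hq0 : q ≠ 0)
    (hq : ∀ N : ℕ, 0 < N → q ^ N ≠ 1) {m k : ℕ} {a : Fin m → ℤ} (ha : ∀ j, a j < m) :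
    (gfMatrix q k a).det = completeProduct q k a := by
  set C : ℤ := 4 * (2 * (m : ℤ) + k - 1) with hC
  set r : ℕ → K := fun i => 2 ^ (2 * (i : ℤ) - k - 2 * m)
        * q ^ ((2 * (i : ℤ) - k - 2 * m) * (2 * (i : ℤ) + k + 2 * m - 3) / 2)
        / qPoch (q ^ 2) (q ^ 2) (2 * m + k - 2 * i) with hr
  set g : Fin m → K := fun j => q ^ (2 * (2 * (m : ℤ) + k) * a j)
    * qPoch (q ^ (4 * ((m : ℤ) - a j))) (q ^ 4) k * q ^ (-(4 * a j * m)) with hg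
  set x : Fin m → K := fun j => q ^ (4 * a j) + q ^ (C - 4 * a j) with hx
  -- Each entry is a row factor times a column factor times a monic polynomial in x j of degree m
  -- minus the one-based row index.
  have hM : gfMatrix q k a = Matrix.of fun i j : Fin m => r ((i : ℕ) + 1) *
      (Matrix.of fun i j : Fin m => g j * (Matrix.of fun i j : Fin m =>
        ∏ s ∈ Finset.range (m - ((i : ℕ) + 1)),
          (x j - (q ^ (4 * ((m : ℤ) - 1 - s)) + q ^ (4 * ((m : ℤ) + k + s))))) i j) i j := by
    ext i j
    rw [gfMatrix, Matrix.of_apply, gf_eq_pathGF]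
    have := pathGF_eq_gfSpecialFormula h2 hq0 hq (m := m) (k := k) (i := (i : ℕ) + 1)
      (by omega) (ha j)
    push_cast at this
    rw [this, gfSpecialFormula]
    simp only [Matrix.of_apply, hr, hg, hx]
    obtain ⟨n, hn⟩ : ∃ n : ℕ, m = (i : ℕ) + 1 + n := ⟨m - (i + 1), by omega⟩
    have e1 : 2 * m + k - 2 * ((i : ℕ) + 1) = n + k + n := by omega
    have e2 : m - ((i : ℕ) + 1) = n := by omega
    have e3 : (((i : ℕ) + 1 : ℕ) : ℤ) = (m : ℤ) - n := by omega
    rw [e1, e2, e3, qPoch_pairing hq0, ← hC]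
    -- The product is even: its first factor has the parity of k and its second the opposite parity.
    obtain ⟨t, ht⟩ : ∃ t : ℤ, (2 * ((m : ℤ) - n) - k - 2 * m) * (2 * ((m : ℤ) - n) + k + 2 * m - 3)
        = 2 * t := by
      rcases Int.even_or_odd' (k : ℤ) with ⟨u, hu | hu⟩
      · exact ⟨(-n - u) * (2 * ((m : ℤ) - n) + k + 2 * m - 3), by rw [hu]; ring⟩
      · exact ⟨(-2 * n - k) * (2 * m - n + u - 1), by rw [hu]; ring⟩
    have e4 : (2 * ((m : ℤ) - n) - k - 2 * m) * (2 * ((m : ℤ) - n) + k + 2 * m - 4 * a j - 3) / 2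
        = t + 2 * (2 * n + k) * a j := by
      rw [show (2 * ((m : ℤ) - n) - k - 2 * m) * (2 * ((m : ℤ) - n) + k + 2 * m - 4 * a j - 3)
        = 2 * (t + 2 * (2 * n + k) * a j) by linear_combination ht]
      exact Int.mul_ediv_cancel_left _ two_ne_zero
    rw [e4, ht, Int.mul_ediv_cancel_left _ two_ne_zero, zpow_add₀ hq0]
    -- Both sides are q^(2k a_j): the row dependence of the prefactor cancels against the power
    -- released by the pairing.
    have e5 : q ^ (2 * (2 * (n : ℤ) + k) * a j) * q ^ (-(4 * a j * n))
        = q ^ (2 * (2 * (m : ℤ) + k) * a j) * q ^ (-(4 * a j * m)) := by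
      rw [← zpow_add₀ hq0, ← zpow_add₀ hq0]
      congr 1
      ring
    linear_combination (2 ^ (2 * ((m : ℤ) - n) - k - 2 * m) * q ^ t
      * qPoch (q ^ (4 * ((m : ℤ) - a j))) (q ^ 4) k
      * (∏ s ∈ Finset.range n, (q ^ (4 * a j) + q ^ (C - 4 * a j)
          - (q ^ (4 * ((m : ℤ) - 1 - s)) + q ^ (4 * ((m : ℤ) + k + s)))))
      / qPoch (q ^ 2) (q ^ 2) (n + k + n)) * e5
  have hxx : ∀ i j, x i - x j = q ^ (C - 4 * a i)
      * ((1 - q ^ (4 * (a i - a j))) * (1 - q ^ (4 * (-2 * (m : ℤ) - k + 1 + a i + a j)))) := by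
    intro i j
    have hi : q ^ (4 * a i) ≠ 0 := zpow_ne_zero _ hq0
    have hj : q ^ (4 * a j) ≠ 0 := zpow_ne_zero _ hq0
    have hCC : q ^ C ≠ 0 := zpow_ne_zero _ hq0
    have e1 : 4 * (a i - a j) = 4 * a i - 4 * a j := by ring
    have e2 : 4 * (-2 * (m : ℤ) - k + 1 + a i + a j) = 4 * a i + 4 * a j - C := by rw [hC]; ring
    simp only [hx]
    rw [e1, e2, zpow_sub₀ hq0, zpow_sub₀ hq0, zpow_sub₀ hq0, zpow_sub₀ hq0, zpow_add₀ hq0]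
    field_simp
    ring
  -- This collects the leftover column powers and the factor q^(C-4a_i) from each Vandermonde
  -- difference; it occurs once for each of the m-1-i indices above the zero-based i.
  have hexp : (∏ j : Fin m, q ^ (-(4 * a j * m))) * (∏ i : Fin m, ∏ _j ∈ Finset.Ioi i,
      q ^ (C - 4 * a i)) = q ^ (4 * ((m : ℤ) * ((m : ℤ) - 1) * (2 * m + k - 1) / 2
        - ∑ l : Fin m, a l * (2 * (m : ℤ) - ((l : ℤ) + 1)))) := by
    have hsum : (m : ℤ) * (m - 1) = 2 * ∑ l : Fin m, ((m : ℤ) - 1 - (l : ℕ)) := by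
      have := sum_range_sub_mul_two ((m : ℤ) - 1) m
      rw [← Fin.sum_univ_eq_sum_range (fun l => ((m : ℤ) - 1 - (l : ℕ)) * 2),
        ← Finset.sum_mul] at this
      linear_combination -this
    have hcard : ∀ i : Fin m, ∏ _j ∈ Finset.Ioi i, q ^ (C - 4 * a i)
        = q ^ ((C - 4 * a i) * ((m : ℤ) - 1 - (i : ℕ))) := by
      intro i
      rw [Finset.prod_const, Fin.card_Ioi, zpow_pow_eq]
      congr 2
      omega
    simp only [hcard]
    rw [prod_zpow_eq_zpow_sum hq0, prod_zpow_eq_zpow_sum hq0, ← zpow_add₀ hq0, hsum, mul_assoc,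
      Int.mul_ediv_cancel_left _ two_ne_zero, ← Finset.sum_add_distrib, Finset.sum_mul,
      ← Finset.sum_sub_distrib, Finset.mul_sum]
    congr 1
    refine Finset.sum_congr rfl fun l _ => ?_
    rw [hC]
    ring
  rw [hM, Matrix.det_mul_column, Matrix.det_mul_row, det_prod_range_sub, completeProduct,
    prod_Icc_one_eq_prod_fin r, ← hexp]
  simp only [hxx, Finset.prod_mul_distrib, hg]
  ring

end Determinant

/-! ### Consecutive vertices of a path -/

/-- `u` and `w` are consecutive entries of `l`. -/
def Consec (l : List (ℤ × ℤ)) (u w : ℤ × ℤ) : Prop := (u, w) ∈ l.zip l.tail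

theorem not_consec_singleton (p u w : ℤ × ℤ) : ¬ Consec [p] u w := by
  simp [Consec]

theorem consec_cons {p v e u w : ℤ × ℤ} {l : List (ℤ × ℤ)} (h : IsPathList v e l) :
    Consec (p :: l) u w ↔ (u = p ∧ w = v) ∨ Consec l u w := by
  cases l with
  | nil => simpa using h.1
  | cons x t =>
    have := h.1
    simp only [List.head?_cons, Option.some.injEq] at this
    subst this
    simp [Consec]

namespace IsPathList

variable {p e u w : ℤ × ℤ} {l : List (ℤ × ℤ)}

theorem of_consec (h : IsPathList p e l) (hc : Consec l u w) : IsStep u w ∧ u ∈ l ∧ w ∈ l := by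
  revert hc
  refine IsPathList.rec_cons (C := fun _ l => Consec l u w → IsStep u w ∧ u ∈ l ∧ w ∈ l) ?_ ?_ h
  · exact fun hc => absurd hc (not_consec_singleton _ _ _)
  · intro p v l hs hl ih hc
    rcases (consec_cons hl).1 hc with ⟨rfl, rfl⟩ | hc
    · exact ⟨hs, List.mem_cons_self, List.mem_cons_of_mem _ hl.start_mem⟩
    · obtain ⟨h1, h2, h3⟩ := ih hc
      exact ⟨h1, List.mem_cons_of_mem _ h2, List.mem_cons_of_mem _ h3⟩

theorem exists_consec_right (h : IsPathList p e l) (hu : u ∈ l) (hne : u ≠ e) :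
    ∃ w, Consec l u w := by
  revert hu
  refine IsPathList.rec_cons (C := fun _ l => u ∈ l → ∃ w, Consec l u w) ?_ ?_ h
  · intro hu
    exact absurd (List.mem_singleton.1 hu) hne
  · intro p v l hs hl ih hu
    rcases List.mem_cons.1 hu with rfl | hu
    · exact ⟨v, (consec_cons hl).2 (Or.inl ⟨rfl, rfl⟩)⟩
    · obtain ⟨w, hw⟩ := ih hu
      exact ⟨w, (consec_cons hl).2 (Or.inr hw)⟩

theorem exists_consec_left (h : IsPathList p e l) (hw : w ∈ l) (hne : w ≠ p) :
    ∃ u, Consec l u w := by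
  revert hw hne
  refine IsPathList.rec_cons (C := fun p l => w ∈ l → w ≠ p → ∃ u, Consec l u w) ?_ ?_ h
  · intro hw hne
    exact absurd (List.mem_singleton.1 hw) hne
  · intro p v l hs hl ih hw hne
    rcases List.mem_cons.1 hw with rfl | hw
    · exact absurd rfl hne
    · by_cases hv : w = v
      · exact ⟨p, (consec_cons hl).2 (Or.inl ⟨rfl, hv⟩)⟩
      · obtain ⟨u, hu⟩ := ih hw hv
        exact ⟨u, (consec_cons hl).2 (Or.inr hu)⟩

theorem ne_end_of_consec (h : IsPathList p e l) (hc : Consec l u w) : u ≠ e := by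
  rintro rfl
  obtain ⟨h1, -, h3⟩ := h.of_consec hc
  have := h1.pot_eq
  have := h.pot_le_end h3
  omega

theorem ne_start_of_consec (h : IsPathList p e l) (hc : Consec l u w) : w ≠ p := by
  rintro rfl
  obtain ⟨h1, h2, -⟩ := h.of_consec hc
  have := h1.pot_eq
  have := h.pot_le h2
  omega

theorem start_notMem {v : ℤ × ℤ} (hs : IsStep p v) (h : IsPathList v e l) : p ∉ l := by
  intro hp
  have := h.pot_le hp
  have := hs.pot_eq
  omega

theorem consec_right_unique (h : IsPathList p e l) {w' : ℤ × ℤ} (hc : Consec l u w)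
    (hc' : Consec l u w') : w = w' := by
  revert hc hc'
  refine IsPathList.rec_cons (C := fun _ l => Consec l u w → Consec l u w' → w = w') ?_ ?_ h
  · exact fun hc => absurd hc (not_consec_singleton _ _ _)
  · intro p v l hs hl ih hc hc'
    rcases (consec_cons hl).1 hc with ⟨rfl, rfl⟩ | hd <;>
      rcases (consec_cons hl).1 hc' with ⟨h1, rfl⟩ | hd'
    · rfl
    · exact absurd (hl.of_consec hd').2.1 (start_notMem hs hl)
    · subst h1
      exact absurd (hl.of_consec hd).2.1 (start_notMem hs hl)
    · exact ih hd hd'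

theorem consec_left_unique (h : IsPathList p e l) {u' : ℤ × ℤ} (hc : Consec l u w)
    (hc' : Consec l u' w) : u = u' := by
  revert hc hc'
  refine IsPathList.rec_cons (C := fun _ l => Consec l u w → Consec l u' w → u = u') ?_ ?_ h
  · exact fun hc => absurd hc (not_consec_singleton _ _ _)
  · intro p v l hs hl ih hc hc'
    rcases (consec_cons hl).1 hc with ⟨rfl, rfl⟩ | hd <;>
      rcases (consec_cons hl).1 hc' with ⟨rfl, h1⟩ | hd'
    · rfl
    · exact absurd rfl (hl.ne_start_of_consec hd')
    · exact absurd h1 (hl.ne_start_of_consec hd)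
    · exact ih hd hd'

/-- Two paths that follow a deterministic relation as long as possible coincide. -/
theorem eq_of_deterministic {s : ℤ × ℤ → ℤ × ℤ → Prop}
    (hs : ∀ u w w', s u w → s u w' → w = w') {e' : ℤ × ℤ} {l' : List (ℤ × ℤ)}
    (h : IsPathList p e l) (h' : IsPathList p e' l') (hl : ∀ u w, Consec l u w → s u w)
    (hl' : ∀ u w, Consec l' u w → s u w) (he : ∀ w, ¬ s e w) (he' : ∀ w, ¬ s e' w) :
    l = l' := by
  revert l'
  refine IsPathList.rec_cons (C := fun p l => (∀ u w, Consec l u w → s u w) → ∀ {l'},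
    IsPathList p e' l' → (∀ u w, Consec l' u w → s u w) → l = l') ?_ ?_ h hl
  · intro _ l' h' hl'
    rcases h'.eq_or_cons with h' | ⟨v, t, -, ht, rfl⟩
    · exact h'.2.symm
    · exact absurd (hl' _ _ ((consec_cons ht).2 (Or.inl ⟨rfl, rfl⟩))) (he _)
  · intro p v l _ hlv ih hl l' h' hl'
    have hpv := hl _ _ ((consec_cons hlv).2 (Or.inl ⟨rfl, rfl⟩))
    rcases h'.eq_or_cons with ⟨rfl, -⟩ | ⟨v', t, -, ht, rfl⟩
    · exact absurd hpv (he' _)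
    · obtain rfl := hs _ _ _ hpv (hl' _ _ ((consec_cons ht).2 (Or.inl ⟨rfl, rfl⟩)))
      rw [ih (fun u w hc => hl _ _ ((consec_cons hlv).2 (Or.inr hc))) ht
        (fun u w hc => hl' _ _ ((consec_cons ht).2 (Or.inr hc)))]

/-- Paths that follow a relation with unique predecessors do not merge. -/
theorem start_eq_of_common {s : ℤ × ℤ → ℤ × ℤ → Prop}
    (hs : ∀ u u' w, s u w → s u' w → u = u') {p' e' : ℤ × ℤ} {l' : List (ℤ × ℤ)}
    (h : IsPathList p e l) (h' : IsPathList p' e' l') (hl : ∀ u w, Consec l u w → s u w)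
    (hl' : ∀ u w, Consec l' u w → s u w) (hp : ∀ u, ¬ s u p) (hp' : ∀ u, ¬ s u p')
    {v : ℤ × ℤ} (hv : v ∈ l) (hv' : v ∈ l') : p = p' := by
  induction hN : (pot v - pot p).toNat using Nat.strong_induction_on generalizing v with
  | _ N ih =>
  by_cases h1 : v = p
  · by_cases h2 : v = p'
    · exact h1.symm.trans h2
    · obtain ⟨u, hu⟩ := h'.exists_consec_left hv' h2
      exact absurd (h1 ▸ hl' _ _ hu) (hp _)
  · obtain ⟨u, hu⟩ := h.exists_consec_left hv h1
    by_cases h2 : v = p'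
    · exact absurd (h2 ▸ hl _ _ hu) (hp' _)
    · obtain ⟨u', hu'⟩ := h'.exists_consec_left hv' h2
      obtain rfl := hs _ _ _ (hl _ _ hu) (hl' _ _ hu')
      obtain ⟨a1, a2, -⟩ := h.of_consec hu
      refine ih _ ?_ a2 (h'.of_consec hu').2.1 rfl
      have := a1.pot_eq
      have := h.pot_le a2
      omega

-- The potential increases strictly along a path, so no vertex is repeated and the product over list
-- positions becomes one over a set of vertices.
open Classical in
theorem listWeight_eq_prod {K : Type*} [Field K] (q : K) (h : IsPathList p e l) :
    listWeight q l = ∏ u ∈ l.toFinset.filter (fun u => Consec l u (u.1 + 1, u.2)),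
      labelWeight q (u.1 - 2 * u.2) := by
  refine IsPathList.rec_cons (C := fun _ l => listWeight q l =
    ∏ u ∈ l.toFinset.filter (fun u => Consec l u (u.1 + 1, u.2)),
      labelWeight q (u.1 - 2 * u.2)) ?_ ?_ h
  · simp [not_consec_singleton]
  · intro p v l hs hl ih
    have hpl := start_notMem hs hl
    rw [listWeight_cons q hl, ih, List.toFinset_cons, Finset.filter_insert]
    have hfil : l.toFinset.filter (fun u => Consec (p :: l) u (u.1 + 1, u.2))
        = l.toFinset.filter (fun u => Consec l u (u.1 + 1, u.2)) := by
      refine Finset.filter_congr fun u hu => ?_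
      rw [consec_cons hl]
      refine or_iff_right ?_
      rintro ⟨rfl, -⟩
      exact hpl (List.mem_toFinset.1 hu)
    have hc : Consec (p :: l) p (p.1 + 1, p.2) ↔ v = (p.1 + 1, p.2) := by
      rw [consec_cons hl]
      constructor
      · rintro (h | h)
        · exact h.2.symm
        · exact absurd (hl.of_consec h).2.1 hpl
      · exact fun h => Or.inl ⟨rfl, h.symm⟩
    rw [hfil]
    by_cases hv : v = (p.1 + 1, p.2)
    · rw [if_pos (hc.2 hv), Finset.prod_insert (by simp [hpl]), stepWeight, if_pos hv]
    · rw [if_neg (fun h => hv (hc.1 h)), stepWeight, if_neg hv, one_mul]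

end IsPathList

/-! ### Triangles and lozenges in terms of vertices -/

/-- The up-pointing triangle that corresponds to a vertex. -/
def upTriangle (u : ℤ × ℤ) : ℤ × ℤ := (u.1, u.1 - 2 * u.2)

/-- The left neighbour of the up-pointing triangle that corresponds to a vertex. -/
def downTriangle (u : ℤ × ℤ) : ℤ × ℤ := (u.1, u.1 - 2 * u.2 - 1)

theorem upTriangle_injective : Function.Injective upTriangle := by
  intro u w h
  simp only [upTriangle, Prod.mk.injEq] at h
  ext <;> omega

theorem downTriangle_injective : Function.Injective downTriangle := by
  intro u w h
  simp only [downTriangle, Prod.mk.injEq] at h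
  ext <;> omega

theorem upTriangle_ne_downTriangle (u w : ℤ × ℤ) : upTriangle u ≠ downTriangle w := by
  intro h
  simp only [upTriangle, downTriangle, Prod.mk.injEq] at h
  omega

theorem eq_upTriangle_of_even {t : ℤ × ℤ} (h : Even (t.1 + t.2)) : ∃ u, t = upTriangle u := by
  obtain ⟨s, hs⟩ := h
  exact ⟨(t.1, t.1 - s), Prod.ext rfl (by simp only [upTriangle]; omega)⟩

theorem eq_downTriangle_of_not_even {t : ℤ × ℤ} (h : ¬ Even (t.1 + t.2)) :
    ∃ u, t = downTriangle u := by
  obtain ⟨s, hs⟩ := Int.not_even_iff_odd.1 h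
  exact ⟨(t.1, t.1 - s - 1), Prod.ext rfl (by simp only [downTriangle]; omega)⟩

theorem even_upTriangle (u : ℤ × ℤ) : Even ((upTriangle u).1 + (upTriangle u).2) :=
  ⟨u.1 - u.2, by simp only [upTriangle]; ring⟩

/-- The lozenge that consists of the triangles of `u` and `w`. -/
def lozenge (u w : ℤ × ℤ) : Finset (ℤ × ℤ) := {upTriangle u, downTriangle w}

theorem mem_lozenge {t u w : ℤ × ℤ} : t ∈ lozenge u w ↔ t = upTriangle u ∨ t = downTriangle w := by
  simp [lozenge]

theorem upTriangle_mem_lozenge {v u w : ℤ × ℤ} : upTriangle v ∈ lozenge u w ↔ v = u := by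
  rw [mem_lozenge, upTriangle_injective.eq_iff, or_iff_left (upTriangle_ne_downTriangle _ _)]

theorem downTriangle_mem_lozenge {v u w : ℤ × ℤ} : downTriangle v ∈ lozenge u w ↔ v = w := by
  rw [mem_lozenge, downTriangle_injective.eq_iff,
    or_iff_right (upTriangle_ne_downTriangle _ _).symm]

theorem lozenge_inj {u w u' w' : ℤ × ℤ} : lozenge u w = lozenge u' w' ↔ u = u' ∧ w = w' := by
  constructor
  · intro h
    exact ⟨upTriangle_mem_lozenge.1 (h ▸ upTriangle_mem_lozenge.2 rfl),
      downTriangle_mem_lozenge.1 (h ▸ downTriangle_mem_lozenge.2 rfl)⟩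
  · rintro ⟨rfl, rfl⟩
    rfl

theorem verticalLozenge_upTriangle (u : ℤ × ℤ) :
    verticalLozenge (upTriangle u) = lozenge u (u.1 + 1, u.2) := by
  simp only [verticalLozenge, lozenge, upTriangle, downTriangle]
  congr 3
  ring

/-- The left neighbour of the up-triangle of u belongs to u itself, the right one to the vertex
below u, and the one under its base to the vertex to the right of u. -/
theorem isLozenge_iff {L : Finset (ℤ × ℤ)} :
    IsLozenge L ↔ ∃ u w, (w = u ∨ IsStep u w) ∧ L = lozenge u w := by
  have e1 : ∀ u, ({upTriangle u, ((upTriangle u).1, (upTriangle u).2 - 1)} : Finset (ℤ × ℤ))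
      = lozenge u u := fun u => rfl
  have e2 : ∀ u, ({upTriangle u, ((upTriangle u).1, (upTriangle u).2 + 1)} : Finset (ℤ × ℤ))
      = lozenge u (u.1, u.2 - 1) := fun u => by
    simp only [lozenge, upTriangle, downTriangle]
    congr 3
    ring
  constructor
  · rintro ⟨t, ht, h⟩
    obtain ⟨u, rfl⟩ := eq_upTriangle_of_even ht
    rw [e1, e2, verticalLozenge_upTriangle] at h
    rcases h with h | h | h
    · exact ⟨u, _, Or.inl rfl, h⟩
    · exact ⟨u, _, Or.inr (Or.inr rfl), h⟩
    · exact ⟨u, _, Or.inr (Or.inl rfl), h⟩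
  · rintro ⟨u, w, h, rfl⟩
    refine ⟨upTriangle u, even_upTriangle u, ?_⟩
    rw [e1, e2, verticalLozenge_upTriangle]
    rcases h with rfl | rfl | rfl
    · exact Or.inl rfl
    · exact Or.inr (Or.inr rfl)
    · exact Or.inr (Or.inl rfl)

/-! ### Tilings and families of paths -/

section Bijection

variable {m : ℕ}

/-- The triangles of the region `R` are the up-pointing triangles of the vertices in `V` that are
not end points `Y j`, and the left neighbours of those of the vertices in `V` that are not
starting points `X i`; moreover, paths from starting points to end points stay in `V`. -/
structure IsPathRegion (R V : Finset (ℤ × ℤ)) (X Y : Fin m → ℤ × ℤ) : Prop where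
  up_mem : ∀ u, upTriangle u ∈ R ↔ u ∈ V ∧ ∀ j, u ≠ Y j
  down_mem : ∀ w, downTriangle w ∈ R ↔ w ∈ V ∧ ∀ i, w ≠ X i
  start_mem : ∀ i, X i ∈ V
  path_mem : ∀ i j l v, IsPathList (X i) (Y j) l → v ∈ l → v ∈ V
  start_inj : Function.Injective X
  end_inj : Function.Injective Y

/-- The relation `r` matches the vertices of `V` that are not end points with those that are not
starting points, and it moves a vertex by at most one step. -/
structure IsMatching (V : Finset (ℤ × ℤ)) (X Y : Fin m → ℤ × ℤ)
    (r : ℤ × ℤ → ℤ × ℤ → Prop) : Prop where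
  move : ∀ {u w}, r u w → w = u ∨ IsStep u w
  left_mem : ∀ {u w}, r u w → u ∈ V ∧ ∀ j, u ≠ Y j
  right_mem : ∀ {u w}, r u w → w ∈ V ∧ ∀ i, w ≠ X i
  exists_right : ∀ {u}, u ∈ V → (∀ j, u ≠ Y j) → ∃ w, r u w
  exists_left : ∀ {w}, w ∈ V → (∀ i, w ≠ X i) → ∃ u, r u w
  right_unique : ∀ {u w w'}, r u w → r u w' → w = w'
  left_unique : ∀ {u u' w}, r u w → r u' w → u = u'

variable {R V : Finset (ℤ × ℤ)} {X Y : Fin m → ℤ × ℤ}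

open Classical in
/-- The set of the lozenges that belong to the pairs of a relation on `V`. -/
def lozengeSet (V : Finset (ℤ × ℤ)) (r : ℤ × ℤ → ℤ × ℤ → Prop) : Finset (Finset (ℤ × ℤ)) :=
  ((V ×ˢ V).filter fun p => r p.1 p.2).image fun p => lozenge p.1 p.2

theorem IsMatching.mem_lozengeSet {r : ℤ × ℤ → ℤ × ℤ → Prop} (hr : IsMatching V X Y r)
    {L : Finset (ℤ × ℤ)} : L ∈ lozengeSet V r ↔ ∃ u w, r u w ∧ L = lozenge u w := by
  simp only [lozengeSet, Finset.mem_image, Finset.mem_filter, Finset.mem_product]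
  constructor
  · rintro ⟨⟨u, w⟩, ⟨-, h⟩, rfl⟩
    exact ⟨u, w, h, rfl⟩
  · rintro ⟨u, w, h, rfl⟩
    exact ⟨(u, w), ⟨⟨(hr.left_mem h).1, (hr.right_mem h).1⟩, h⟩, rfl⟩

theorem IsMatching.lozenge_mem_lozengeSet {r : ℤ × ℤ → ℤ × ℤ → Prop} (hr : IsMatching V X Y r)
    {u w : ℤ × ℤ} : lozenge u w ∈ lozengeSet V r ↔ r u w := by
  rw [hr.mem_lozengeSet]
  constructor
  · rintro ⟨u', w', h, h'⟩
    obtain ⟨rfl, rfl⟩ := lozenge_inj.1 h'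
    exact h
  · exact fun h => ⟨u, w, h, rfl⟩

theorem IsMatching.isLozengeTiling (hR : IsPathRegion R V X Y) {r : ℤ × ℤ → ℤ × ℤ → Prop}
    (hr : IsMatching V X Y r) : IsLozengeTiling R (lozengeSet V r) := by
  refine ⟨?_, ?_, ?_⟩
  · intro L hL
    obtain ⟨u, w, h, rfl⟩ := hr.mem_lozengeSet.1 hL
    exact isLozenge_iff.2 ⟨u, w, hr.move h, rfl⟩
  · intro L hL L' hL' hne
    obtain ⟨u, w, h, rfl⟩ := hr.mem_lozengeSet.1 hL
    obtain ⟨u', w', h', rfl⟩ := hr.mem_lozengeSet.1 hL'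
    rw [Function.onFun, id, id, Finset.disjoint_left]
    intro t ht ht'
    apply hne
    rcases mem_lozenge.1 ht with rfl | rfl
    · obtain rfl := upTriangle_mem_lozenge.1 ht'
      rw [hr.right_unique h h']
    · obtain rfl := downTriangle_mem_lozenge.1 ht'
      rw [hr.left_unique h h']
  · ext t
    simp only [Finset.mem_biUnion, id]
    constructor
    · rintro ⟨L, hL, ht⟩
      obtain ⟨u, w, h, rfl⟩ := hr.mem_lozengeSet.1 hL
      rcases mem_lozenge.1 ht with rfl | rfl
      · exact (hR.up_mem u).2 (hr.left_mem h)
      · exact (hR.down_mem w).2 (hr.right_mem h)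
    · intro ht
      by_cases he : Even (t.1 + t.2)
      · obtain ⟨u, rfl⟩ := eq_upTriangle_of_even he
        have hu := (hR.up_mem u).1 ht
        obtain ⟨w, hw⟩ := hr.exists_right hu.1 hu.2
        exact ⟨_, hr.lozenge_mem_lozengeSet.2 hw, upTriangle_mem_lozenge.2 rfl⟩
      · obtain ⟨w, rfl⟩ := eq_downTriangle_of_not_even he
        have hw := (hR.down_mem w).1 ht
        obtain ⟨u, hu⟩ := hr.exists_left hw.1 hw.2
        exact ⟨_, hr.lozenge_mem_lozengeSet.2 hu, downTriangle_mem_lozenge.2 rfl⟩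

/-- Covering gives the existence of partners and disjointness of the lozenges gives their
uniqueness. -/
theorem isMatching_of_isLozengeTiling (hR : IsPathRegion R V X Y) {T : Finset (Finset (ℤ × ℤ))}
    (hT : IsLozengeTiling R T) : IsMatching V X Y fun u w => lozenge u w ∈ T := by
  obtain ⟨h1, h2, h3⟩ := hT
  have sub : ∀ L ∈ T, ∀ t ∈ L, t ∈ R := fun L hL t ht =>
    h3 ▸ Finset.mem_biUnion.2 ⟨L, hL, ht⟩
  have ex : ∀ t ∈ R, ∃ u w, lozenge u w ∈ T ∧ t ∈ lozenge u w := by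
    intro t ht
    rw [← h3, Finset.mem_biUnion] at ht
    obtain ⟨L, hL, ht⟩ := ht
    obtain ⟨u, w, -, rfl⟩ := isLozenge_iff.1 (h1 L hL)
    exact ⟨u, w, hL, ht⟩
  have uniq : ∀ L ∈ T, ∀ L' ∈ T, ∀ t, t ∈ L → t ∈ L' → L = L' := by
    intro L hL L' hL' t ht ht'
    by_contra hne
    exact Finset.disjoint_left.1 (h2 hL hL' hne) ht ht'
  constructor
  · intro u w h
    obtain ⟨u', w', h', h''⟩ := isLozenge_iff.1 (h1 _ h)
    obtain ⟨rfl, rfl⟩ := lozenge_inj.1 h''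
    exact h'
  · exact fun h => (hR.up_mem _).1 (sub _ h _ (upTriangle_mem_lozenge.2 rfl))
  · exact fun h => (hR.down_mem _).1 (sub _ h _ (downTriangle_mem_lozenge.2 rfl))
  · intro u hu hu'
    obtain ⟨u', w, h, ht⟩ := ex _ ((hR.up_mem u).2 ⟨hu, hu'⟩)
    obtain rfl := upTriangle_mem_lozenge.1 ht
    exact ⟨w, h⟩
  · intro w hw hw'
    obtain ⟨u, w', h, ht⟩ := ex _ ((hR.down_mem w).2 ⟨hw, hw'⟩)
    obtain rfl := downTriangle_mem_lozenge.1 ht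
    exact ⟨u, h⟩
  · intro u w w' h h'
    exact (lozenge_inj.1 (uniq _ h _ h' (upTriangle u) (upTriangle_mem_lozenge.2 rfl)
      (upTriangle_mem_lozenge.2 rfl))).2
  · intro u u' w h h'
    exact (lozenge_inj.1 (uniq _ h _ h' (downTriangle w) (downTriangle_mem_lozenge.2 rfl)
      (downTriangle_mem_lozenge.2 rfl))).1

/-- Vertices on one of the paths are related to their successors, all other vertices to
themselves. -/
def familyRel (V : Finset (ℤ × ℤ)) (f : Fin m → List (ℤ × ℤ)) (u w : ℤ × ℤ) : Prop :=
  (∃ i, Consec (f i) u w) ∨ (w = u ∧ u ∈ V ∧ ∀ i, u ∉ f i)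

variable {σ : Equiv.Perm (Fin m)} {f : Fin m → List (ℤ × ℤ)}

/-- The paths together use all starting and end points, so a vertex off the paths is neither and may
be matched with itself. Disjointness makes successors and predecessors unique across different
paths. -/
theorem isMatching_familyRel (hR : IsPathRegion R V X Y) (hf : f ∈ disjointFamilies X (Y ∘ σ)) :
    IsMatching V X Y (familyRel V f) := by
  have hp := (mem_disjointFamilies.1 hf).1
  have hV : ∀ {i v}, v ∈ f i → v ∈ V := fun {i v} hv => hR.path_mem i (σ i) _ _ (hp i) hv
  have hend : ∀ {i j}, Y j ∈ f i → Y j = (Y ∘ σ) i := by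
    intro i j h
    have h1 : Y j ∈ f (σ⁻¹ j) := by simpa using (hp (σ⁻¹ j)).end_mem
    obtain rfl := eq_of_mem_disjointFamilies hf h h1
    simp
  have hstart : ∀ {i j}, X j ∈ f i → X j = X i := by
    intro i j h
    rw [eq_of_mem_disjointFamilies hf h (hp j).start_mem]
  constructor
  · rintro u w (⟨i, h⟩ | ⟨rfl, -, -⟩)
    · exact Or.inr ((hp i).of_consec h).1
    · exact Or.inl rfl
  · rintro u w (⟨i, h⟩ | ⟨rfl, h, h'⟩)
    · have hu := ((hp i).of_consec h).2.1
      refine ⟨hV hu, ?_⟩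
      rintro j rfl
      exact (hp i).ne_end_of_consec h (hend hu)
    · refine ⟨h, ?_⟩
      rintro j rfl
      exact h' (σ⁻¹ j) (by simpa using (hp (σ⁻¹ j)).end_mem)
  · rintro u w (⟨i, h⟩ | ⟨rfl, h, h'⟩)
    · have hw := ((hp i).of_consec h).2.2
      refine ⟨hV hw, ?_⟩
      rintro j rfl
      exact (hp i).ne_start_of_consec h (hstart hw)
    · refine ⟨h, ?_⟩
      rintro j rfl
      exact h' j (hp j).start_mem
  · intro u hu hu'
    by_cases h : ∃ i, u ∈ f i
    · obtain ⟨i, hi⟩ := h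
      obtain ⟨w, hw⟩ := (hp i).exists_consec_right hi (hu' _)
      exact ⟨w, Or.inl ⟨i, hw⟩⟩
    · push Not at h
      exact ⟨u, Or.inr ⟨rfl, hu, h⟩⟩
  · intro w hw hw'
    by_cases h : ∃ i, w ∈ f i
    · obtain ⟨i, hi⟩ := h
      obtain ⟨u, hu⟩ := (hp i).exists_consec_left hi (hw' _)
      exact ⟨u, Or.inl ⟨i, hu⟩⟩
    · push Not at h
      exact ⟨w, Or.inr ⟨rfl, hw, h⟩⟩
  · rintro u w w' (⟨i, h⟩ | ⟨rfl, -, h⟩) (⟨i', h'⟩ | ⟨rfl, -, h'⟩)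
    · obtain rfl := eq_of_mem_disjointFamilies hf ((hp i).of_consec h).2.1
        ((hp i').of_consec h').2.1
      exact (hp i).consec_right_unique h h'
    · exact absurd ((hp i).of_consec h).2.1 (h' i)
    · exact absurd ((hp i').of_consec h').2.1 (h i')
    · rfl
  · rintro u u' w (⟨i, h⟩ | ⟨rfl, -, h⟩) (⟨i', h'⟩ | ⟨rfl, -, h'⟩)
    · obtain rfl := eq_of_mem_disjointFamilies hf ((hp i).of_consec h).2.2
        ((hp i').of_consec h').2.2
      exact (hp i).consec_left_unique h h'
    · exact absurd ((hp i).of_consec h).2.2 (h' i)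
    · exact absurd ((hp i').of_consec h').2.2 (h i')
    · rfl

/-- Each path is recovered by following the relation from its start until no successor exists, which
happens exactly at an end point. -/
theorem family_eq_of_familyRel_eq (hR : IsPathRegion R V X Y) {σ' : Equiv.Perm (Fin m)}
    {f' : Fin m → List (ℤ × ℤ)} (hf : f ∈ disjointFamilies X (Y ∘ σ))
    (hf' : f' ∈ disjointFamilies X (Y ∘ σ'))
    (h : ∀ u w, familyRel V f u w ↔ familyRel V f' u w) : f = f' := by
  have hm := isMatching_familyRel hR hf
  funext i
  have hi := (mem_disjointFamilies.1 hf).1 i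
  have hi' := (mem_disjointFamilies.1 hf').1 i
  exact hi.eq_of_deterministic (s := familyRel V f) (fun _ _ _ => hm.right_unique) hi'
    (fun u w hc => Or.inl ⟨i, hc⟩) (fun u w hc => (h u w).2 (Or.inl ⟨i, hc⟩))
    (fun w hw => (hm.left_mem hw).2 _ rfl) (fun w hw => (hm.left_mem hw).2 _ rfl)

/-- A vertex that is not matched with itself is the start of a path to an end point, along matched
pairs. -/
theorem IsMatching.exists_path {r : ℤ × ℤ → ℤ × ℤ → Prop} (hr : IsMatching V X Y r) {u : ℤ × ℤ}
    (hu : u ∈ V) (hu' : ¬ r u u) :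
    ∃ j l, IsPathList u (Y j) l ∧ ∀ v w, Consec l v w → r v w := by
  obtain ⟨B, hB⟩ : ∃ B : ℤ, ∀ v ∈ V, pot v ≤ B := by
    obtain ⟨B, hB⟩ := (V.image pot).bddAbove
    exact ⟨B, fun v hv => hB (by simpa using ⟨v.1, v.2, hv, rfl⟩)⟩
  induction hN : (B - pot u).toNat using Nat.strong_induction_on generalizing u with
  | _ N ih =>
  by_cases hY : ∀ j, u ≠ Y j
  · obtain ⟨w, hw⟩ := hr.exists_right hu hY
    have hne : w ≠ u := fun h => hu' (h ▸ hw)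
    have hs := (hr.move hw).resolve_left hne
    -- A fixed w would have the two predecessors u and w, so a chain that has started to move never
    -- stops at a fixed vertex; the bounded potential makes it reach an end point.
    have hww : ¬ r w w := fun h => hne (hr.left_unique h hw)
    have h1 := hs.pot_eq
    have h2 := hB _ (hr.right_mem hw).1
    obtain ⟨j, l, hl, hc⟩ := ih _ (by omega) (hr.right_mem hw).1 hww rfl
    refine ⟨j, u :: l, hl.cons hs, fun v v' hv => ?_⟩
    rcases (consec_cons hl).1 hv with ⟨rfl, rfl⟩ | hv
    · exact hw
    · exact hc _ _ hv
  · push Not at hY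
    obtain ⟨j, rfl⟩ := hY
    exact ⟨j, [Y j], IsPathList.singleton _, fun v w h => absurd h (not_consec_singleton _ _ _)⟩

/-- All vertices that are not matched with themselves lie on paths along matched pairs from the
starting points to the end points. -/
theorem IsMatching.exists_mem {r : ℤ × ℤ → ℤ × ℤ → Prop} (hr : IsMatching V X Y r)
    {j : Fin m → Fin m} (hp : ∀ i, IsPathList (X i) (Y (j i)) (f i))
    (hc : ∀ i v w, Consec (f i) v w → r v w) {u : ℤ × ℤ} (hu : u ∈ V) (hu' : ¬ r u u) :
    ∃ i, u ∈ f i := by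
  obtain ⟨B, hB⟩ : ∃ B : ℤ, ∀ v ∈ V, B ≤ pot v := by
    obtain ⟨B, hB⟩ := (V.image pot).bddBelow
    exact ⟨B, fun v hv => hB (by simpa using ⟨v.1, v.2, hv, rfl⟩)⟩
  induction hN : (pot u - B).toNat using Nat.strong_induction_on generalizing u with
  | _ N ih =>
  by_cases hX : ∀ i, u ≠ X i
  · obtain ⟨v, hv⟩ := hr.exists_left hu hX
    have hne : u ≠ v := fun h => hu' (by rw [← h] at hv; exact hv)
    have hs := (hr.move hv).resolve_left hne
    have hvv : ¬ r v v := fun h => hne (hr.right_unique hv h)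
    have h1 := hs.pot_eq
    have h2 := hB _ (hr.left_mem hv).1
    obtain ⟨i, hi⟩ := ih _ (by omega) (hr.left_mem hv).1 hvv rfl
    -- The predecessor v lies on a path and is not an end point, so its successor there is its
    -- unique partner u.
    obtain ⟨w, hw⟩ := (hp i).exists_consec_right hi ((hr.left_mem hv).2 _)
    rw [hr.right_unique hv (hc _ _ _ hw)]
    exact ⟨i, ((hp i).of_consec hw).2.2⟩
  · push Not at hX
    obtain ⟨i, rfl⟩ := hX
    exact ⟨i, (hp i).start_mem⟩

/-- Starting points are never partners of anything, so the chains from them move at once and run to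
end points. Unique predecessors keep the chains disjoint, so their ends are distinct and define a
permutation. It suffices to check one inclusion of relations, because both are matchings. -/
theorem IsMatching.exists_family (hR : IsPathRegion R V X Y) {r : ℤ × ℤ → ℤ × ℤ → Prop}
    (hr : IsMatching V X Y r) : ∃ (σ : Equiv.Perm (Fin m)) (f : Fin m → List (ℤ × ℤ)),
      f ∈ disjointFamilies X (Y ∘ σ) ∧ ∀ u w, familyRel V f u w ↔ r u w := by
  have hX : ∀ i u, ¬ r u (X i) := fun i u h => (hr.right_mem h).2 i rfl
  choose j f hp hc using fun i => hr.exists_path (hR.start_mem i) (hX i _)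
  have hdisj : ∀ {i i' v}, v ∈ f i → v ∈ f i' → i = i' := by
    intro i i' v hv hv'
    exact hR.start_inj ((hp i).start_eq_of_common (s := r) (fun _ _ _ => hr.left_unique) (hp i')
      (hc i) (hc i') (hX i) (hX i') hv hv')
  have hj : Function.Injective j := fun i i' h =>
    hdisj (hp i).end_mem (by rw [h]; exact (hp i').end_mem)
  have hf : f ∈ disjointFamilies X
      (Y ∘ Equiv.ofBijective j (Finite.injective_iff_bijective.1 hj)) :=
    mem_disjointFamilies.2 ⟨hp, fun i i' h v hv hv' => h (hdisj hv hv')⟩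
  have hle : ∀ u w, familyRel V f u w → r u w := by
    rintro u w (⟨i, h⟩ | ⟨rfl, h, h'⟩)
    · exact hc i u w h
    · by_contra hw
      obtain ⟨i, hi⟩ := hr.exists_mem hp hc h hw
      exact h' i hi
  refine ⟨_, f, hf, fun u w => ⟨hle u w, fun h => ?_⟩⟩
  obtain ⟨w', hw'⟩ := (isMatching_familyRel hR hf).exists_right (hr.left_mem h).1 (hr.left_mem h).2
  rw [hr.right_unique h (hle _ _ hw')]
  exact hw'

/-- Vertical lozenges correspond to the horizontal steps of the paths, and the abscissa of the
up-triangle of (a, b) is the step label a - 2b. -/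
theorem tilingWeight_lozengeSet_familyRel {K : Type*} [Field K] (q : K)
    (hR : IsPathRegion R V X Y) (hf : f ∈ disjointFamilies X (Y ∘ σ)) :
    tilingWeight q R (lozengeSet V (familyRel V f)) = ∏ i, listWeight q (f i) := by
  classical
  have hm := isMatching_familyRel hR hf
  have hp := (mem_disjointFamilies.1 hf).1
  have hset : R.filter (fun t => Even (t.1 + t.2) ∧
      verticalLozenge t ∈ lozengeSet V (familyRel V f))
      = (Finset.univ.biUnion fun i =>
          (f i).toFinset.filter (fun u => Consec (f i) u (u.1 + 1, u.2))).image upTriangle := by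
    ext t
    simp only [Finset.mem_filter, Finset.mem_image, Finset.mem_biUnion, Finset.mem_univ, true_and,
      List.mem_toFinset]
    constructor
    · rintro ⟨-, he, hv⟩
      obtain ⟨u, rfl⟩ := eq_upTriangle_of_even he
      rw [verticalLozenge_upTriangle, hm.lozenge_mem_lozengeSet] at hv
      rcases hv with ⟨i, h⟩ | ⟨h, -, -⟩
      · exact ⟨u, ⟨i, ((hp i).of_consec h).2.1, h⟩, rfl⟩
      · have := congrArg Prod.fst h
        simp at this
    · rintro ⟨u, ⟨i, -, h⟩, rfl⟩
      have h' : familyRel V f u (u.1 + 1, u.2) := Or.inl ⟨i, h⟩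
      refine ⟨(hR.up_mem u).2 (hm.left_mem h'), even_upTriangle u, ?_⟩
      rw [verticalLozenge_upTriangle, hm.lozenge_mem_lozengeSet]
      exact h'
  rw [tilingWeight]
  calc _ = ∏ t ∈ R.filter (fun t => Even (t.1 + t.2) ∧
            verticalLozenge t ∈ lozengeSet V (familyRel V f)), labelWeight q t.2 := by
        congr!
    _ = _ := by
        rw [hset, Finset.prod_image upTriangle_injective.injOn, Finset.prod_biUnion]
        · refine Finset.prod_congr rfl fun i _ => ?_
          rw [(hp i).listWeight_eq_prod]
          congr!
        · intro i _ j _ hij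
          rw [Function.onFun, Finset.disjoint_left]
          intro v hv hv'
          simp only [Finset.mem_filter, List.mem_toFinset] at hv hv'
          exact hij (eq_of_mem_disjointFamilies hf hv.1 hv'.1)

end Bijection

/-! ### The dented quarter hexagon as a path region -/

section Region

variable {m k : ℕ} {a : Fin m → ℤ}

theorem NonIntersectingFamily.mem_disjointFamilies (F : NonIntersectingFamily k a) :
    (fun i => (F.1.2 i).1) ∈ disjointFamilies initialPoint (terminalPoint k a ∘ F.1.1) :=
  QuarterHexagon.mem_disjointFamilies.2 ⟨fun i => (F.1.2 i).2, F.2⟩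

/-- The last vertices of the paths determine the permutation, because the terminal points are
distinct. -/
theorem NonIntersectingFamily.ext (ha : Function.Injective a) {F F' : NonIntersectingFamily k a}
    (h : ∀ i, (F.1.2 i).1 = (F'.1.2 i).1) : F = F' := by
  obtain ⟨⟨σ, P⟩, hP⟩ := F
  obtain ⟨⟨σ', P'⟩, hP'⟩ := F'
  simp only at h
  obtain rfl : σ = σ' := by
    ext i
    have h1 := (P i).2.2.1
    rw [h i] at h1
    have h2 := Option.some.inj (h1.symm.trans (P' i).2.2.1)
    simp only [terminalPoint, Prod.mk.injEq, true_and] at h2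
    rw [ha h2]
  obtain rfl : P = P' := funext fun i => Subtype.ext (h i)
  rfl

/-- Tilings of a path region correspond to families of non-intersecting paths. -/
theorem exists_equiv_of_isPathRegion {K : Type*} [Field K] (q : K) {R V : Finset (ℤ × ℤ)}
    (ha : Function.Injective a) (hR : IsPathRegion R V initialPoint (terminalPoint k a)) :
    ∃ e : lozengeTilings R ≃ NonIntersectingFamily k a,
      ∀ T, familyWeight q (e T) = tilingWeight q R T.1 := by
  let Φ : NonIntersectingFamily k a → lozengeTilings R := fun F =>
    ⟨lozengeSet V (familyRel V fun i => (F.1.2 i).1), (mem_lozengeTilings _ _).2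
      ((isMatching_familyRel hR F.mem_disjointFamilies).isLozengeTiling hR)⟩
  have hΦ : Function.Bijective Φ := by
    constructor
    · intro F F' h
      have h1 := congrArg Subtype.val h
      simp only [Φ] at h1
      refine NonIntersectingFamily.ext ha fun i => congrFun (family_eq_of_familyRel_eq hR
        F.mem_disjointFamilies F'.mem_disjointFamilies fun u w => ?_) i
      rw [← (isMatching_familyRel hR F.mem_disjointFamilies).lozenge_mem_lozengeSet, h1,
        (isMatching_familyRel hR F'.mem_disjointFamilies).lozenge_mem_lozengeSet]
    · rintro ⟨T, hT⟩
      have hT := (mem_lozengeTilings _ _).1 hT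
      have hr := isMatching_of_isLozengeTiling hR hT
      obtain ⟨σ, f, hf, hfr⟩ := hr.exists_family hR
      have hf' := QuarterHexagon.mem_disjointFamilies.1 hf
      refine ⟨⟨⟨σ, fun i => ⟨f i, hf'.1 i⟩⟩, hf'.2⟩, Subtype.ext ?_⟩
      ext L
      simp only [Φ]
      rw [(isMatching_familyRel hR hf).mem_lozengeSet]
      simp only [hfr]
      constructor
      · rintro ⟨u, w, h, rfl⟩
        exact h
      · intro hL
        obtain ⟨u, w, -, rfl⟩ := isLozenge_iff.1 (hT.1 L hL)
        exact ⟨u, w, hL, rfl⟩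
  refine ⟨(Equiv.ofBijective Φ hΦ).symm, fun T => ?_⟩
  obtain ⟨F, rfl⟩ := (Equiv.ofBijective Φ hΦ).surjective T
  rw [Equiv.symm_apply_apply]
  exact (tilingWeight_lozengeSet_familyRel q hR F.mem_disjointFamilies).symm

/-- The vertices whose up-pointing triangles belong to the region. -/
def regionVertices (m k n : ℕ) : Finset (ℤ × ℤ) :=
  (Finset.Icc 1 (2 * (m : ℤ) - 1 + k) ×ˢ Finset.Icc (-(n : ℤ)) ((m : ℤ) - 1)).filter
    fun u => 2 * u.2 ≤ u.1 - 1

/-- The dents are the up-triangles of the terminal points. A down-triangle to the left of an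
up-triangle in the region is missing exactly when it would have abscissa 0, that is, for the
vertices (2b+1, b) with 0 ≤ b ≤ m-1, which are the initial points. The straight part of the left
boundary is the condition b ≤ m-1. -/
theorem isPathRegion_generalRegion {n : ℕ} (ha : Function.Injective a)
    (hn : ∀ j, -(n : ℤ) ≤ a j) :
    IsPathRegion (generalRegion m k n \ dents (2 * (m : ℤ) - 1 + k) a) (regionVertices m k n)
      initialPoint (terminalPoint k a) := by
  constructor
  · intro u
    simp only [upTriangle, generalRegion, quarterHexagon, dents, regionVertices, terminalPoint,
      Finset.mem_sdiff, Finset.mem_filter, Finset.mem_product, Finset.mem_Icc, Finset.mem_image,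
      Finset.mem_univ, true_and, not_exists, ne_eq, Prod.ext_iff]
    refine and_congr (by omega) (forall_congr' fun j => not_congr (by omega))
  · intro w
    simp only [downTriangle, generalRegion, quarterHexagon, dents, regionVertices, initialPoint,
      Finset.mem_sdiff, Finset.mem_filter, Finset.mem_product, Finset.mem_Icc, Finset.mem_image,
      Finset.mem_univ, true_and, not_exists, ne_eq, Prod.ext_iff]
    constructor
    · rintro ⟨h, -⟩
      exact ⟨by omega, fun i => by omega⟩
    · rintro ⟨h, h'⟩
      refine ⟨?_, fun j => by omega⟩
      by_cases hw : w.2 < 0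
      · omega
      -- The only initial point at this height is the one with zero-based index w.2; excluding it
      -- raises the abscissa of the down-triangle to at least 1.
      · have := h' ⟨w.2.toNat, by omega⟩
        simp only at this
        omega
  · intro i
    simp only [regionVertices, initialPoint, Finset.mem_filter, Finset.mem_product, Finset.mem_Icc]
    omega
  · intro i j l v hl hv
    have h1 := hl.mem_bounds v hv
    have h2 := hn j
    simp only [initialPoint, terminalPoint] at h1
    simp only [regionVertices, Finset.mem_filter, Finset.mem_product, Finset.mem_Icc]
    omega
  · intro i j h
    simp only [initialPoint, Prod.mk.injEq] at h
    ext
    omega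
  · intro i j h
    simp only [terminalPoint, Prod.mk.injEq, true_and] at h
    exact ha h

theorem generalRegion_zero (m n : ℕ) :
    generalRegion m 0 n = quarterHexagon (2 * (m : ℤ) - 1) n := by
  ext t
  simp only [generalRegion, quarterHexagon, Finset.mem_filter, Finset.mem_product, Finset.mem_Icc]
  omega

theorem generalRegion_one (m n : ℕ) : generalRegion m 1 n = quarterHexagon (2 * (m : ℤ)) n := by
  ext t
  simp only [generalRegion, quarterHexagon, Finset.mem_filter, Finset.mem_product, Finset.mem_Icc]
  omega

theorem tilingGF_eq_det {K : Type*} [Field K] (q : K) {n : ℕ} (ha : StrictMono a)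
    (hn : ∀ j, -(n : ℤ) ≤ a j) :
    tilingGF q (generalRegion m k n \ dents (2 * (m : ℤ) - 1 + k) a) = (gfMatrix q k a).det := by
  obtain ⟨e, he⟩ := exists_equiv_of_isPathRegion q ha.injective
    (isPathRegion_generalRegion (k := k) ha.injective hn)
  rw [← sum_familyWeight_eq_det q ha, tilingGF, ← Finset.sum_coe_sort]
  exact Fintype.sum_equiv e _ _ fun T => (he T).symm

end Region

end QuarterHexagon

end

/-! ### Assembly of the claims -/

theorem mainTheorem2 {K : Type*} [Field K] (q : K) (h2 : (2 : K) ≠ 0) (hq0 : q ≠ 0)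
    (hq : ∀ N : ℕ, 0 < N → q ^ N ≠ 1) :
    -- the generating functions of single lattice paths
    (∀ a b c d : ℤ,
      ((c < a ∨ b < d) → QuarterHexagon.gf q a b c d = 0) ∧
      (a ≤ c → d ≤ b → QuarterHexagon.gf q a b c d = QuarterHexagon.gfFormula q a b c d)) ∧
    (∀ (m k : ℕ) (a : Fin m → ℤ), StrictMono a →
      -- families of non-intersecting lattice paths
      (∑ F : QuarterHexagon.NonIntersectingFamily k a, QuarterHexagon.familyWeight q F
        = (QuarterHexagon.gfMatrix q k a).det) ∧
      -- the determinant factorizes completely (and vanishes if some `a_j` is not below `m`)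
      ((∃ j, (m : ℤ) ≤ a j) → (QuarterHexagon.gfMatrix q k a).det = 0) ∧
      ((∀ j, a j < m) →
        (∀ i j, QuarterHexagon.gfMatrix q k a i j
          = QuarterHexagon.gfSpecialFormula q m k ((i : ℕ) + 1) (a j)) ∧
        (QuarterHexagon.gfMatrix q k a).det = QuarterHexagon.completeProduct q k a ∧
        -- lozenge tilings, for every length `n` of the top side such that all dents lie on the base
        (∀ n : ℕ, (∀ j, -(n : ℤ) ≤ a j) →
          (∃ e : QuarterHexagon.lozengeTilings (QuarterHexagon.generalRegion m k n \
                QuarterHexagon.dents (2 * (m : ℤ) - 1 + k) a)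
              ≃ QuarterHexagon.NonIntersectingFamily k a,
            ∀ T, QuarterHexagon.familyWeight q (e T)
              = QuarterHexagon.tilingWeight q (QuarterHexagon.generalRegion m k n \
                  QuarterHexagon.dents (2 * (m : ℤ) - 1 + k) a) T.1) ∧
          QuarterHexagon.tilingGF q (QuarterHexagon.generalRegion m k n \
              QuarterHexagon.dents (2 * (m : ℤ) - 1 + k) a)
            = (QuarterHexagon.gfMatrix q k a).det ∧
          QuarterHexagon.tilingGF q (QuarterHexagon.generalRegion m k n \
              QuarterHexagon.dents (2 * (m : ℤ) - 1 + k) a)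
            = QuarterHexagon.completeProduct q k a))) ∧
    -- quarter hexagons with dents of odd height (`k = 0`) and of even height (`k = 1`)
    (∀ (m n : ℕ) (a : Fin m → ℤ), StrictMono a → (∀ j, -(n : ℤ) ≤ a j ∧ a j < m) →
      QuarterHexagon.tilingGF q (QuarterHexagon.quarterHexagon (2 * (m : ℤ) - 1) n \
          QuarterHexagon.dents (2 * (m : ℤ) - 1) a)
        = QuarterHexagon.completeProduct q 0 a ∧
      QuarterHexagon.tilingGF q (QuarterHexagon.quarterHexagon (2 * (m : ℤ)) n \
          QuarterHexagon.dents (2 * (m : ℤ)) a)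
        = QuarterHexagon.completeProduct q 1 a) := by
  refine ⟨fun a b c d => ⟨fun h => ?_, fun hac hdb => ?_⟩, fun m k a ha => ⟨?_, ?_, fun ham =>
    ⟨fun i j => ?_, ?_, fun n hn => ⟨?_, ?_, ?_⟩⟩⟩, fun m n a ha han => ⟨?_, ?_⟩⟩
  · rw [QuarterHexagon.gf_eq_pathGF, QuarterHexagon.pathGF_eq_zero q h]
  · rw [QuarterHexagon.gf_eq_pathGF, QuarterHexagon.pathGF_eq_gfFormula h2 hq0 hq hac hdb]
  · exact QuarterHexagon.sum_familyWeight_eq_det q ha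
  · rintro ⟨j, hj⟩
    exact QuarterHexagon.det_gfMatrix_eq_zero q hj
  · have := QuarterHexagon.pathGF_eq_gfSpecialFormula h2 hq0 hq (k := k) (i := (i : ℕ) + 1)
      i.isLt (ham j)
    rw [← this, QuarterHexagon.gfMatrix, Matrix.of_apply, QuarterHexagon.gf_eq_pathGF]
    push_cast
    rfl
  · exact QuarterHexagon.det_eq_completeProduct h2 hq0 hq ham
  · exact QuarterHexagon.exists_equiv_of_isPathRegion q ha.injective
      (QuarterHexagon.isPathRegion_generalRegion ha.injective hn)
  · exact QuarterHexagon.tilingGF_eq_det q ha hn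
  · rw [QuarterHexagon.tilingGF_eq_det q ha hn,
      QuarterHexagon.det_eq_completeProduct h2 hq0 hq ham]
  · have := QuarterHexagon.tilingGF_eq_det (k := 0) q ha fun j => (han j).1
    rwa [QuarterHexagon.generalRegion_zero, Nat.cast_zero, add_zero,
      QuarterHexagon.det_eq_completeProduct h2 hq0 hq fun j => (han j).2] at this
  · have := QuarterHexagon.tilingGF_eq_det (k := 1) q ha fun j => (han j).1
    rwa [QuarterHexagon.generalRegion_one, Nat.cast_one, sub_add_cancel,
      QuarterHexagon.det_eq_completeProduct h2 hq0 hq fun j => (han j).2] at this
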